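/- Manifolds are real, finite-dimensional, smooth ($C^\infty$), Hausdorff, second countable and without boundary; Lie groups and vector bundles are smooth. A *double Lie group* $\mathbb G=(G;G_1,G_2)$ with core $G_0$ is an exact sequence of Lie groups $1\to G_0\xrightarrow{i} G\xrightarrow{\varphi=(\varphi_1,\varphi_2)}G_1\times G_2\to 1$; put $K_1=\varphi^{-1}(\{e\}\times G_2)$ and $K_2=\varphi^{-1}(G_1\times\{e\})$. A *$\mathbb G$-double principal bundle* $\mathbb P=(P;P_1,P_2;M)$ consists of a principal $G_1$-bundle $\lambda_1:P_1\to M$, a principal $G_2$-bundle $\lambda_2:P_2\to M$, a manifold $P$ with a smooth right action of $G$, and maps $\pi_i:P\to P_i$ with $\lambda_1\pi_1=\lambda_2\pi_2=:\pi$, such that $\pi_1:P\to P_1$ is a principal $K_1$-bundle and $\pi_2:P\to P_2$ is a principal $K_2$-bundle for the restricted actions, $\pi_1(pk)=\pi_1(p)\varphi_1(k)$ for $k\in K_2$, and $\pi_2(pk)=\pi_2(p)\varphi_2(k)$ for $k\in K_1$. A *double vector bundle* $(E;E_1,E_2;M)$ consists of vector bundles $E\to E_1$, $E\to E_2$, $E_1\to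 M$, $E_2\to M$ such that the projection, zero section, addition and scalar multiplications of each of the two vector bundle structures on $E$ are morphisms of vector bundles with respect to the other structure. Its *core* is the set of points of $E$ that lie over the zero vectors of $E_1$ and $E_2$ at one and the same point of $M$. A *double vector space* $\mathbb V=(V;V_1,V_2)$, with projections $\sigma_i:V\to V_i$ and core $V_0$, is a double vector bundle over a point. A *representation* of $\mathbb G$ on $\mathbb V$ consists of smooth actions $\rho,\rho_1,\rho_2$ of $G,G_1,G_2$ on $V,V_1,V_2$ such that $(\rho(g);\rho_1(\varphi_1(g)),\rho_2(\varphi_2(g)))$ is an automorphism of the double vector space $\mathbb V$ for every $g\in G$. For a right $H$-space $X$ and a left $H$-space $F$, $X\times_H F$ is the quotient of $X\times F$ by $(x,v)\sim(xh,h^{-1}v)$. **Theorem.** Let $\mathbb P=(P;P_1,P_2;M)$ be a $\mathbb G$-double principal bundle and let $\mathbb V=(V;V_1,V_2)$ be a double vector space with a representation of $\mathbb G$. Then the quotient spaces $P\times_GV$, $P_1\times_{G_1}V_1$, $P_2\times_{G_2}V_2$ are smooth manifolds such that the quotient maps from $P\times V$, $P_1\times V_1$, $P_2\times V_2$ are smooth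 submersions, and $$(P\times_GV;\;P_1\times_{G_1}V_1,\;P_2\times_{G_2}V_2;\;M)$$ is a double vector bundle with the projections $$\Pi_i([p,v])=[\pi_i(p),\sigma_i(v)],\qquad \Lambda_i([p_i,v_i])=\lambda_i(p_i)\qquad(i=1,2)$$ and with the linear structures induced by those of $\mathbb V$: $[p,v]+_i[p,w]=[p,v+_iw]$ whenever $\sigma_i(v)=\sigma_i(w)$, $r\cdot_i[p,v]=[p,r\cdot_iv]$, with zero sections $[\pi_i(p),v_i]\mapsto[p,0_i(v_i)]$, where $0_i$ is the zero section of $V\to V_i$, and likewise on the side bundles. Moreover $P\times_GV_0$ is a smooth vector bundle over $M$ with projection $\Lambda_0([p,v_0])=\pi(p)$, and it is the core: the map $P\times_GV_0\to P\times_GV$, $[p,v_0]\mapsto[p,v_0]$, is a smooth embedding over $M$ whose image is the core, and each of the two linear structures on $P\times_GV$ restricts to the linear structure of $P\times_GV_0$. -/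

import Mathlib

open scoped Manifold ContDiff Topology

/-- A smooth manifold: a Hausdorff second countable space with a `C^∞` atlas modelled on
`ℝ^dim`, without boundary. -/
class SmoothMfd (X : Type*) [TopologicalSpace X] where
  dim : ℕ
  chartedSpace : ChartedSpace (EuclideanSpace ℝ (Fin dim)) X
  isManifold : IsManifold (𝓡 dim) ∞ X
  t2 : T2Space X
  secondCountable : SecondCountableTopology X

attribute [reducible, instance] SmoothMfd.chartedSpace

attribute [instance] SmoothMfd.isManifold SmoothMfd.t2 SmoothMfd.secondCountable

/-- The model of a smooth manifold. -/
noncomputable abbrev SmoothMfd.I (X : Type*) [TopologicalSpace X] [SmoothMfd X] :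
    ModelWithCorners ℝ (EuclideanSpace ℝ (Fin (SmoothMfd.dim X)))
      (EuclideanSpace ℝ (Fin (SmoothMfd.dim X))) :=
  𝓡 (SmoothMfd.dim X)

/-- The one-point manifold. -/
noncomputable instance : SmoothMfd Unit where
  dim := 0
  chartedSpace := ChartedSpace.ofDiscreteTopology
  isManifold :=
    letI : ChartedSpace (EuclideanSpace ℝ (Fin 0)) Unit := ChartedSpace.ofDiscreteTopology
    IsManifold.of_discreteTopology ∞
  t2 := inferInstance
  secondCountable := inferInstance

/-- Smooth maps between smooth manifolds. -/
abbrev SmoothMap {X Y : Type*} [TopologicalSpace X] [SmoothMfd X] [TopologicalSpace Y]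
    [SmoothMfd Y] (f : X → Y) : Prop :=
  ContMDiff (SmoothMfd.I X) (SmoothMfd.I Y) ∞ f

/-- Smooth maps defined on a product of two smooth manifolds. -/
abbrev SmoothMap₂ {X Y Z : Type*} [TopologicalSpace X] [SmoothMfd X] [TopologicalSpace Y]
    [SmoothMfd Y] [TopologicalSpace Z] [SmoothMfd Z] (f : X × Y → Z) : Prop :=
  ContMDiff ((SmoothMfd.I X).prod (SmoothMfd.I Y)) (SmoothMfd.I Z) ∞ f

/-- A map from a product of two manifolds is a smooth submersion: it is smooth with surjective
differentials. -/
def IsSmoothSubmersion₂ {X Y Z : Type*} [TopologicalSpace X] [SmoothMfd X] [TopologicalSpace Y]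
    [SmoothMfd Y] [TopologicalSpace Z] [SmoothMfd Z] (f : X × Y → Z) : Prop :=
  SmoothMap₂ f ∧ ∀ x, Function.Surjective
    (mfderiv ((SmoothMfd.I X).prod (SmoothMfd.I Y)) (SmoothMfd.I Z) f x)

/-- A smooth embedding: a smooth topological embedding with injective differentials. -/
def IsSmoothEmb {X Y : Type*} [TopologicalSpace X] [SmoothMfd X] [TopologicalSpace Y]
    [SmoothMfd Y] (f : X → Y) : Prop :=
  SmoothMap f ∧ Topology.IsEmbedding f ∧
    ∀ x, Function.Injective (mfderiv (SmoothMfd.I X) (SmoothMfd.I Y) f x)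

section VectorBundles

/-- A smooth real vector bundle with total space `X`, base `B` and typical fibre `ℝ^rank`, in terms
of its structure maps: the projection, the zero section, the fibrewise addition (`add x y` is
meaningful only if `proj x = proj y`) and the fibrewise scalar multiplication. Around every point
of the base there is a smooth local trivialization which is linear on the fibres; as it is
bijective on fibres, the vector space axioms hold in every fibre. -/
structure SmoothVB (X B : Type*) [TopologicalSpace X] [SmoothMfd X]
    [TopologicalSpace B] [SmoothMfd B] where
  proj : X → B
  zero : B → X
  add : X → X → X
  smul : ℝ → X → X
  rank : ℕ
  proj_zero : ∀ b, proj (zero b) = b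
  proj_add : ∀ x y, proj x = proj y → proj (add x y) = proj x
  proj_smul : ∀ (r : ℝ) x, proj (smul r x) = proj x
  locally_trivial : ∀ b : B, ∃ e : Bundle.Trivialization (EuclideanSpace ℝ (Fin rank)) proj,
    b ∈ e.baseSet ∧
    ContMDiffOn (SmoothMfd.I X) ((SmoothMfd.I B).prod (𝓡 rank)) ∞ e e.source ∧
    ContMDiffOn ((SmoothMfd.I B).prod (𝓡 rank)) (SmoothMfd.I X) ∞
      e.toOpenPartialHomeomorph.symm e.target ∧
    (∀ c ∈ e.baseSet, (e (zero c)).2 = 0) ∧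
    (∀ x y, proj x ∈ e.baseSet → proj x = proj y → (e (add x y)).2 = (e x).2 + (e y).2) ∧
    (∀ (r : ℝ) x, proj x ∈ e.baseSet → (e (smul r x)).2 = r • (e x).2)

variable {X B X' B' : Type*} [TopologicalSpace X] [SmoothMfd X] [TopologicalSpace B] [SmoothMfd B]
  [TopologicalSpace X'] [SmoothMfd X'] [TopologicalSpace B'] [SmoothMfd B']

/-- `(f, f₀)` is a morphism of vector bundles: `f` is smooth, covers the smooth map `f₀` of the
bases, and is linear on every fibre. -/
structure IsVBHom (A : SmoothVB X B) (A' : SmoothVB X' B') (f : X → X') (f₀ : B → B') : Prop where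
  smooth : SmoothMap f
  smooth_base : SmoothMap f₀
  proj : ∀ x, A'.proj (f x) = f₀ (A.proj x)
  add : ∀ x y, A.proj x = A.proj y → f (A.add x y) = A'.add (f x) (f y)
  smul : ∀ (r : ℝ) x, f (A.smul r x) = A'.smul r (f x)

/-- `0 • x` is the zero vector of the fibre of `x`. -/
theorem SmoothVB.zero_smul (A : SmoothVB X B) (x : X) : A.smul 0 x = A.zero (A.proj x) := by
  obtain ⟨e, hb, -, -, hz, -, hs⟩ := A.locally_trivial (A.proj x)
  have h1 : A.smul 0 x ∈ e.source := by
    rw [e.mem_source, A.proj_smul]; exact hb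
  have h2 : A.zero (A.proj x) ∈ e.source := by
    rw [e.mem_source, A.proj_zero]; exact hb
  refine e.injOn h1 h2 (Prod.ext ?_ ?_)
  · rw [e.proj_toFun _ h1, e.proj_toFun _ h2, A.proj_smul, A.proj_zero]
  · exact ((hs 0 x hb).trans (_root_.zero_smul ℝ _)).trans (hz _ hb).symm

/-- A morphism of vector bundles maps zero vectors to zero vectors. -/
theorem IsVBHom.map_zero {A : SmoothVB X B} {A' : SmoothVB X' B'} {f : X → X'} {f₀ : B → B'}
    (h : IsVBHom A A' f f₀) (b : B) : f (A.zero b) = A'.zero (f₀ b) := by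
  have h1 : A.smul 0 (A.zero b) = A.zero b := by
    rw [A.zero_smul, A.proj_zero]
  rw [← h1, h.smul, A'.zero_smul, h.proj, A.proj_zero]

end VectorBundles

section DoubleVectorBundles

/-- A double vector bundle `(E; E₁, E₂; M)`: `E` has two vector bundle structures `I : E → E₁` and
`II : E → E₂`, the side bundles are `S₁ : E₁ → M` and `S₂ : E₂ → M`, and the projection, the
zero section, the scalar multiplications and the addition of each structure on `E` are
morphisms of vector bundles with respect to the other structure. For the addition of `I` this means
that `E ×_{E₁} E → E`, over the addition `E₂ ×_M E₂ → E₂`, is compatible with the projections and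
linear, the linear structure of `E ×_{E₁} E → E₂ ×_M E₂` being componentwise (the smoothness
is part of the local triviality). -/
structure DoubleVB (E E₁ E₂ M : Type*) [TopologicalSpace E] [SmoothMfd E]
    [TopologicalSpace E₁] [SmoothMfd E₁] [TopologicalSpace E₂] [SmoothMfd E₂]
    [TopologicalSpace M] [SmoothMfd M] where
  I : SmoothVB E E₁
  II : SmoothVB E E₂
  S₁ : SmoothVB E₁ M
  S₂ : SmoothVB E₂ M
  projI : IsVBHom II S₁ I.proj S₂.proj
  zeroI : IsVBHom S₁ II I.zero S₂.zero
  smulI : ∀ r : ℝ, IsVBHom II II (I.smul r) (S₂.smul r)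
  addI_proj : ∀ x y, I.proj x = I.proj y → II.proj (I.add x y) = S₂.add (II.proj x) (II.proj y)
  addI_add : ∀ x y x' y', I.proj x = I.proj y → I.proj x' = I.proj y' →
    II.proj x = II.proj x' → II.proj y = II.proj y' →
    I.add (II.add x x') (II.add y y') = II.add (I.add x y) (I.add x' y')
  addI_smul : ∀ (r : ℝ) x y, I.proj x = I.proj y →
    I.add (II.smul r x) (II.smul r y) = II.smul r (I.add x y)
  projII : IsVBHom I S₂ II.proj S₁.proj
  zeroII : IsVBHom S₂ I II.zero S₁.zero
  smulII : ∀ r : ℝ, IsVBHom I I (II.smul r) (S₁.smul r)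
  addII_proj : ∀ x y, II.proj x = II.proj y → I.proj (II.add x y) = S₁.add (I.proj x) (I.proj y)
  addII_add : ∀ x y x' y', II.proj x = II.proj y → II.proj x' = II.proj y' →
    I.proj x = I.proj x' → I.proj y = I.proj y' →
    II.add (I.add x x') (I.add y y') = I.add (II.add x y) (II.add x' y')
  addII_smul : ∀ (r : ℝ) x y, II.proj x = II.proj y →
    II.add (I.smul r x) (I.smul r y) = I.smul r (II.add x y)

variable {E E₁ E₂ M : Type*} [TopologicalSpace E] [SmoothMfd E]
  [TopologicalSpace E₁] [SmoothMfd E₁] [TopologicalSpace E₂] [SmoothMfd E₂]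
  [TopologicalSpace M] [SmoothMfd M]
  {E' E₁' E₂' M' : Type*} [TopologicalSpace E'] [SmoothMfd E']
  [TopologicalSpace E₁'] [SmoothMfd E₁'] [TopologicalSpace E₂'] [SmoothMfd E₂']
  [TopologicalSpace M'] [SmoothMfd M']

/-- The core of a double vector bundle: the points of `E` over a zero vector of `E₁` and over a
zero vector of `E₂`, at the same point of `M`. -/
def DoubleVB.core (D : DoubleVB E E₁ E₂ M) : Set E :=
  {u | ∃ m : M, D.I.proj u = D.S₁.zero m ∧ D.II.proj u = D.S₂.zero m}

/-- `j` identifies the vector bundle `C → M` with the core of `D`: it is a smooth embedding whose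
image is the core, over the identity of `M`, and the linear structure on `C` is the
restriction of each of the two linear structures on `E`. -/
structure IsCoreBundle {K : Type*} [TopologicalSpace K] [SmoothMfd K]
    (D : DoubleVB E E₁ E₂ M) (C : SmoothVB K M) (j : K → E) : Prop where
  emb : IsSmoothEmb j
  range : Set.range j = D.core
  proj₁ : ∀ x, D.S₁.proj (D.I.proj (j x)) = C.proj x
  proj₂ : ∀ x, D.S₂.proj (D.II.proj (j x)) = C.proj x
  addI : ∀ x y, C.proj x = C.proj y → j (C.add x y) = D.I.add (j x) (j y)
  addII : ∀ x y, C.proj x = C.proj y → j (C.add x y) = D.II.add (j x) (j y)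
  smulI : ∀ (r : ℝ) x, j (C.smul r x) = D.I.smul r (j x)
  smulII : ∀ (r : ℝ) x, j (C.smul r x) = D.II.smul r (j x)

/-- A morphism `(a; a₁, a₂; a_M)` of double vector bundles. -/
structure IsDoubleVBHom (D : DoubleVB E E₁ E₂ M) (D' : DoubleVB E' E₁' E₂' M')
    (a : E → E') (a₁ : E₁ → E₁') (a₂ : E₂ → E₂') (aM : M → M') : Prop where
  homI : IsVBHom D.I D'.I a a₁
  homII : IsVBHom D.II D'.II a a₂
  hom₁ : IsVBHom D.S₁ D'.S₁ a₁ aM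
  hom₂ : IsVBHom D.S₂ D'.S₂ a₂ aM

theorem IsDoubleVBHom.map_core {D : DoubleVB E E₁ E₂ M} {D' : DoubleVB E' E₁' E₂' M'}
    {a : E → E'} {a₁ : E₁ → E₁'} {a₂ : E₂ → E₂'} {aM : M → M'}
    (h : IsDoubleVBHom D D' a a₁ a₂ aM) {u : E} (hu : u ∈ D.core) : a u ∈ D'.core := by
  obtain ⟨m, h1, h2⟩ := hu
  refine ⟨aM m, ?_, ?_⟩
  · rw [h.homI.proj, h1, h.hom₁.map_zero]
  · rw [h.homII.proj, h2, h.hom₂.map_zero]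

end DoubleVectorBundles

/-- A double vector space: a double vector bundle over a point. -/
abbrev DoubleVS (V V₁ V₂ : Type*) [TopologicalSpace V] [SmoothMfd V]
    [TopologicalSpace V₁] [SmoothMfd V₁] [TopologicalSpace V₂] [SmoothMfd V₂] :=
  DoubleVB V V₁ V₂ Unit

/-- A double Lie group `(G; G₁, G₂)` with core `G₀`: an exact sequence of Lie groups
`1 → G₀ → G → G₁ × G₂ → 1`. -/
structure DoubleLieGroup (G G₁ G₂ G₀ : Type*)
    [Group G] [TopologicalSpace G] [SmoothMfd G] [LieGroup (SmoothMfd.I G) ∞ G]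
    [Group G₁] [TopologicalSpace G₁] [SmoothMfd G₁] [LieGroup (SmoothMfd.I G₁) ∞ G₁]
    [Group G₂] [TopologicalSpace G₂] [SmoothMfd G₂] [LieGroup (SmoothMfd.I G₂) ∞ G₂]
    [Group G₀] [TopologicalSpace G₀] [SmoothMfd G₀] [LieGroup (SmoothMfd.I G₀) ∞ G₀] where
  i : G₀ →* G
  φ : G →* G₁ × G₂
  smooth_i : SmoothMap i
  smooth_φ : ContMDiff (SmoothMfd.I G) ((SmoothMfd.I G₁).prod (SmoothMfd.I G₂)) ∞ φ
  injective_i : Function.Injective i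
  exact : i.range = φ.ker
  surjective_φ : Function.Surjective φ

/-- A smooth right action of a Lie group on a manifold. -/
structure SmoothRightAction (X G : Type*) [TopologicalSpace X] [SmoothMfd X]
    [Group G] [TopologicalSpace G] [SmoothMfd G] where
  act : X → G → X
  act_one : ∀ x, act x 1 = x
  act_mul : ∀ x g h, act x (g * h) = act (act x g) h
  smooth : SmoothMap₂ (fun z : X × G => act z.1 z.2)

/-- `π : X → B` is a principal bundle whose structure group is the closed subgroup `K` of the Lie
group `G`, acting on `X` through the given action of `G` (`K = ⊤` gives principal `G`-bundles).
Locally over the base there is a smooth section `s` and a smooth map `τ` to `K`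
with `x = s (π x) · τ x`, that is, `x ↦ (π x, τ x)` is an equivariant diffeomorphism onto `U × K`
with inverse `(u, k) ↦ s u · k`. A map to the embedded submanifold `K` of `G` is smooth if and
only if it is smooth as a map to `G`. -/
structure IsPrincipalBundle {X G B : Type*} [TopologicalSpace X] [SmoothMfd X]
    [Group G] [TopologicalSpace G] [SmoothMfd G] [TopologicalSpace B] [SmoothMfd B]
    (a : SmoothRightAction X G) (K : Subgroup G) (π : X → B) : Prop where
  smooth : SmoothMap π
  free : ∀ x, ∀ k ∈ K, a.act x k = x → k = 1
  invariant : ∀ x, ∀ k ∈ K, π (a.act x k) = π x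
  locally_trivial : ∀ b : B, ∃ (U : Set B) (s : B → X) (τ : X → G), IsOpen U ∧ b ∈ U ∧
    ContMDiffOn (SmoothMfd.I B) (SmoothMfd.I X) ∞ s U ∧
    ContMDiffOn (SmoothMfd.I X) (SmoothMfd.I G) ∞ τ (π ⁻¹' U) ∧
    (∀ u ∈ U, π (s u) = u) ∧
    (∀ x, π x ∈ U → τ x ∈ K ∧ a.act (s (π x)) (τ x) = x)

section DoublePrincipalBundles

variable {G G₁ G₂ G₀ : Type*}
  [Group G] [TopologicalSpace G] [SmoothMfd G] [LieGroup (SmoothMfd.I G) ∞ G]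
  [Group G₁] [TopologicalSpace G₁] [SmoothMfd G₁] [LieGroup (SmoothMfd.I G₁) ∞ G₁]
  [Group G₂] [TopologicalSpace G₂] [SmoothMfd G₂] [LieGroup (SmoothMfd.I G₂) ∞ G₂]
  [Group G₀] [TopologicalSpace G₀] [SmoothMfd G₀] [LieGroup (SmoothMfd.I G₀) ∞ G₀]

/-- The component `φ₁ : G → G₁`. -/
def DoubleLieGroup.φ₁ (𝔾 : DoubleLieGroup G G₁ G₂ G₀) : G →* G₁ := (MonoidHom.fst G₁ G₂).comp 𝔾.φ

/-- The component `φ₂ : G → G₂`. -/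
def DoubleLieGroup.φ₂ (𝔾 : DoubleLieGroup G G₁ G₂ G₀) : G →* G₂ := (MonoidHom.snd G₁ G₂).comp 𝔾.φ

/-- The closed normal subgroup `K₁ = φ⁻¹({1} × G₂)`. -/
def DoubleLieGroup.K₁ (𝔾 : DoubleLieGroup G G₁ G₂ G₀) : Subgroup G := 𝔾.φ₁.ker

/-- The closed normal subgroup `K₂ = φ⁻¹(G₁ × {1})`. -/
def DoubleLieGroup.K₂ (𝔾 : DoubleLieGroup G G₁ G₂ G₀) : Subgroup G := 𝔾.φ₂.ker

/-- A `𝔾`-double principal bundle `(P; P₁, P₂; M)`. The group `G` acts smoothly on `P`; the groups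
`K₁` and `K₂`, which act through the action of `G`, make `P` a principal bundle over `P₁` and
over `P₂` respectively; `P₁` and `P₂` are principal `G₁`- and `G₂`-bundles over `M`; and
`(π₁, φ₁) : P(K₂, P₂) → P₁(G₁, M)` and `(π₂, φ₂) : P(K₁, P₁) → P₂(G₂, M)` are homomorphisms of
principal bundles. -/
structure DoublePB (𝔾 : DoubleLieGroup G G₁ G₂ G₀) (P P₁ P₂ M : Type*)
    [TopologicalSpace P] [SmoothMfd P] [TopologicalSpace P₁] [SmoothMfd P₁]
    [TopologicalSpace P₂] [SmoothMfd P₂] [TopologicalSpace M] [SmoothMfd M] where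
  actP : SmoothRightAction P G
  actP₁ : SmoothRightAction P₁ G₁
  actP₂ : SmoothRightAction P₂ G₂
  π₁ : P → P₁
  π₂ : P → P₂
  l₁ : P₁ → M
  l₂ : P₂ → M
  principal_I : IsPrincipalBundle actP 𝔾.K₁ π₁
  principal_II : IsPrincipalBundle actP 𝔾.K₂ π₂
  principal₁ : IsPrincipalBundle actP₁ ⊤ l₁
  principal₂ : IsPrincipalBundle actP₂ ⊤ l₂
  comm : ∀ p, l₁ (π₁ p) = l₂ (π₂ p)
  equivariant₁ : ∀ p, ∀ k ∈ 𝔾.K₂, π₁ (actP.act p k) = actP₁.act (π₁ p) (𝔾.φ₁ k)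
  equivariant₂ : ∀ p, ∀ k ∈ 𝔾.K₁, π₂ (actP.act p k) = actP₂.act (π₂ p) (𝔾.φ₂ k)

/-- A representation of the double Lie group `𝔾` on the double vector space `𝕍`: smooth
representations `ρ`, `ρ₁`, `ρ₂` of `G`, `G₁`, `G₂` on `V`, `V₁`, `V₂` such that, for every `g`, the
triple `(ρ g; ρ₁ (φ₁ g), ρ₂ (φ₂ g))` is an automorphism of `𝕍` (its inverse is the triple of `g⁻¹`).
The homomorphism of the cores is the restriction of `ρ` to `G₀ = ker φ`. -/
structure DoubleRep {V V₁ V₂ : Type*} [TopologicalSpace V] [SmoothMfd V]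
    [TopologicalSpace V₁] [SmoothMfd V₁] [TopologicalSpace V₂] [SmoothMfd V₂]
    (𝔾 : DoubleLieGroup G G₁ G₂ G₀) (𝕍 : DoubleVS V V₁ V₂) where
  ρ : G →* Equiv.Perm V
  ρ₁ : G₁ →* Equiv.Perm V₁
  ρ₂ : G₂ →* Equiv.Perm V₂
  smooth : SmoothMap₂ (fun z : G × V => ρ z.1 z.2)
  smooth₁ : SmoothMap₂ (fun z : G₁ × V₁ => ρ₁ z.1 z.2)
  smooth₂ : SmoothMap₂ (fun z : G₂ × V₂ => ρ₂ z.1 z.2)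
  hom : ∀ g, IsDoubleVBHom 𝕍 𝕍 (ρ g) (ρ₁ (𝔾.φ₁ g)) (ρ₂ (𝔾.φ₂ g)) id

/-- The induced action of `G` on the core `V₀` of `𝕍`. -/
def DoubleRep.coreAct {V V₁ V₂ : Type*} [TopologicalSpace V] [SmoothMfd V]
    [TopologicalSpace V₁] [SmoothMfd V₁] [TopologicalSpace V₂] [SmoothMfd V₂]
    {𝔾 : DoubleLieGroup G G₁ G₂ G₀} {𝕍 : DoubleVS V V₁ V₂} (R : DoubleRep 𝔾 𝕍)
    (g : G) (v : 𝕍.core) : 𝕍.core :=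
  ⟨R.ρ g v, (R.hom g).map_core v.2⟩

end DoublePrincipalBundles

/-- The associated space `X ×_G F`: the quotient of `X × F` by `(x, v) ∼ (x g, g⁻¹ v)`, where `act`
is a right action on `X` and `l` a left action on `F`. -/
def Assoc {X G F : Type*} [Group G] (act : X → G → X) (l : G → F → F) : Type _ :=
  Quot (fun z w : X × F => ∃ g : G, w = (act z.1 g, l g⁻¹ z.2))

/-- The associated space carries the quotient topology. -/
instance {X G F : Type*} [Group G] [TopologicalSpace X] [TopologicalSpace F]
    (act : X → G → X) (l : G → F → F) : TopologicalSpace (Assoc act l) :=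
  inferInstanceAs (TopologicalSpace (Quot _))

/-- The class `[x, v]` in `X ×_G F`. -/
def Assoc.mk {X G F : Type*} [Group G] (act : X → G → X) (l : G → F → F) (x : X) (v : F) :
    Assoc act l :=
  Quot.mk _ (x, v)

section AssociatedSpaces

variable {G G₁ G₂ G₀ : Type*}
  [Group G] [TopologicalSpace G] [SmoothMfd G] [LieGroup (SmoothMfd.I G) ∞ G]
  [Group G₁] [TopologicalSpace G₁] [SmoothMfd G₁] [LieGroup (SmoothMfd.I G₁) ∞ G₁]
  [Group G₂] [TopologicalSpace G₂] [SmoothMfd G₂] [LieGroup (SmoothMfd.I G₂) ∞ G₂]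
  [Group G₀] [TopologicalSpace G₀] [SmoothMfd G₀] [LieGroup (SmoothMfd.I G₀) ∞ G₀]
  {P P₁ P₂ M V V₁ V₂ : Type*}
  [TopologicalSpace P] [SmoothMfd P] [TopologicalSpace P₁] [SmoothMfd P₁]
  [TopologicalSpace P₂] [SmoothMfd P₂] [TopologicalSpace M] [SmoothMfd M]
  [TopologicalSpace V] [SmoothMfd V] [TopologicalSpace V₁] [SmoothMfd V₁]
  [TopologicalSpace V₂] [SmoothMfd V₂]
  {𝔾 : DoubleLieGroup G G₁ G₂ G₀} {𝕍 : DoubleVS V V₁ V₂}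
  (ℙ : DoublePB 𝔾 P P₁ P₂ M) (R : DoubleRep 𝔾 𝕍)

/-- `P ×_G V`. -/
abbrev DoublePB.Total := Assoc ℙ.actP.act (fun g v => R.ρ g v)

/-- `P₁ ×_{G₁} V₁`. -/
abbrev DoublePB.Side₁ := Assoc ℙ.actP₁.act (fun g v => R.ρ₁ g v)

/-- `P₂ ×_{G₂} V₂`. -/
abbrev DoublePB.Side₂ := Assoc ℙ.actP₂.act (fun g v => R.ρ₂ g v)

/-- `P ×_G V₀`. -/
abbrev DoublePB.Core := Assoc ℙ.actP.act R.coreAct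

/-- `[p, v]` in `P ×_G V`. -/
abbrev DoublePB.q (p : P) (v : V) : ℙ.Total R := Assoc.mk _ _ p v

/-- `[p, v]` in `P₁ ×_{G₁} V₁`. -/
abbrev DoublePB.q₁ (p : P₁) (v : V₁) : ℙ.Side₁ R := Assoc.mk _ _ p v

/-- `[p, v]` in `P₂ ×_{G₂} V₂`. -/
abbrev DoublePB.q₂ (p : P₂) (v : V₂) : ℙ.Side₂ R := Assoc.mk _ _ p v

/-- `[p, v]` in `P ×_G V₀`. -/
abbrev DoublePB.q₀ (p : P) (v : 𝕍.core) : ℙ.Core R := Assoc.mk _ _ p v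

end AssociatedSpaces

/-!
The four spaces are handled uniformly as bundles associated with one principal bundle. The composite
`P → P₁ → M` is a principal `G`-bundle, and each of `P ×_G V`, `P₁ ×_{G₁} V₁`, `P₂ ×_{G₂} V₂`,
`P ×_G V₀` and `M` is associated with it, with fibre `V`, `V₁`, `V₂`, `V₀` and a point: a point `p`
of `P` is a frame, that is, a bijection of the standard fibre with the fibre over the image of `p`
in `M`, and for the side bundles it is `v ↦ [πᵢ(p), v]` (`IsAssocBundle`,
`IsAssocBundle.comp`). A local section of `P → M` trivializes all these bundles simultaneously. So
every `G`-equivariant smooth structure on the fibres passes to the bundles, where it is smooth because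
it is locally the product of an open subset of `M` with the structure on the fibres
(`IsAssocBundle.smoothMap`, `IsAssocBundle.exists_smoothVB`), and identities pass because elements
over the same point of `M` can be written in a common frame
(`IsAssocBundle.exists_doubleVB`, `IsAssocVB.isCoreBundle`).

Two facts need more than this formalism.

* `P → M` is a principal bundle (`IsPrincipalBundle.trans`). The local triviality uses that the
  surjective homomorphism `G → G₁` has smooth local sections. Without second countability it fails: for
  discrete `G` and `G₁` of positive dimension there are no such sections. The open mapping
  theorem makes the homomorphism open, translations make its rank constant, and the constant
  rank theorem together with a bound on the Hausdorff dimension makes it a submersion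
  (`MonoidHom.exists_contMDiffOn_section`).
* The core of a double vector space is a vector space embedded in `V`
  (`DoubleVB.exists_core_smoothVB`), on which both linear structures agree. The additions agree by
  the interchange law (`DoubleVB.add_eq_add_of_mem_core`), and then the scalar multiplications
  agree because continuous additive maps are linear (`DoubleVB.smul_eq_smul_of_mem_core`).
-/

/-! ### Manifolds glued from local product structures -/

theorem contMDiff_finAddEquivProd (a b : ℕ) :
    ContMDiff (𝓡 (a + b)) ((𝓡 a).prod (𝓡 b)) ∞
      (M' := ModelProd (EuclideanSpace ℝ (Fin a)) (EuclideanSpace ℝ (Fin b)))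
      (EuclideanSpace.finAddEquivProd (𝕜 := ℝ) (n := a) (m := b)) := by
  rw [← modelWithCornersSelf_prod]
  exact (EuclideanSpace.finAddEquivProd (𝕜 := ℝ) (n := a) (m := b)).contDiff.contMDiff

theorem contMDiff_finAddEquivProd_symm (a b : ℕ) :
    ContMDiff ((𝓡 a).prod (𝓡 b)) (𝓡 (a + b)) ∞
      (M := ModelProd (EuclideanSpace ℝ (Fin a)) (EuclideanSpace ℝ (Fin b)))
      (EuclideanSpace.finAddEquivProd (𝕜 := ℝ) (n := a) (m := b)).symm := by
  rw [← modelWithCornersSelf_prod]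
  exact (EuclideanSpace.finAddEquivProd (𝕜 := ℝ) (n := a) (m := b)).symm.contDiff.contMDiff

section Gluing

variable {M F E : Type*} [TopologicalSpace M] [SmoothMfd M] [TopologicalSpace F] [SmoothMfd F]
  [TopologicalSpace E]

/-- The chart of `M × F` around `y`, read in a single Euclidean space. -/
noncomputable def prodChart (y : M × F) : OpenPartialHomeomorph (M × F)
    (EuclideanSpace ℝ (Fin (SmoothMfd.dim M + SmoothMfd.dim F))) :=
  (chartAt (ModelProd (EuclideanSpace ℝ (Fin (SmoothMfd.dim M)))
    (EuclideanSpace ℝ (Fin (SmoothMfd.dim F)))) y).trans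
    (EuclideanSpace.finAddEquivProd (𝕜 := ℝ) (n := SmoothMfd.dim M)
      (m := SmoothMfd.dim F)).symm.toHomeomorph.toOpenPartialHomeomorph

theorem mem_prodChart_source (y : M × F) : y ∈ (prodChart y).source := by
  simp [prodChart]

theorem contMDiffOn_prodChart (y : M × F) :
    ContMDiffOn ((SmoothMfd.I M).prod (SmoothMfd.I F)) (𝓡 (SmoothMfd.dim M + SmoothMfd.dim F)) ∞
      (prodChart y) (prodChart y).source := by
  have h := contMDiffOn_chart (I := (SmoothMfd.I M).prod (SmoothMfd.I F)) (n := ∞) (x := y)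
  refine ((contMDiff_finAddEquivProd_symm (SmoothMfd.dim M) (SmoothMfd.dim F)).comp_contMDiffOn
    (h.mono ?_))
  intro x hx
  exact hx.1

theorem contMDiffOn_prodChart_symm (y : M × F) :
    ContMDiffOn (𝓡 (SmoothMfd.dim M + SmoothMfd.dim F)) ((SmoothMfd.I M).prod (SmoothMfd.I F)) ∞
      (prodChart y).symm (prodChart y).target := by
  have h := contMDiffOn_chart_symm (I := (SmoothMfd.I M).prod (SmoothMfd.I F)) (n := ∞) (x := y)
  refine h.comp (contMDiff_finAddEquivProd (SmoothMfd.dim M) (SmoothMfd.dim F)).contMDiffOn ?_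
  intro x hx
  exact hx.2

/-- A space covered by the domains of homeomorphisms onto open subsets of `M × F` with smooth
transition maps is a smooth manifold, and the given homeomorphisms are diffeomorphisms. -/
theorem exists_smoothMfd_of_local_prod [T2Space E] [SecondCountableTopology E]
    (Φ : E → OpenPartialHomeomorph E (M × F)) (hmem : ∀ e, e ∈ (Φ e).source)
    (hcompat : ∀ e e', ContMDiffOn ((SmoothMfd.I M).prod (SmoothMfd.I F))
      ((SmoothMfd.I M).prod (SmoothMfd.I F)) ∞ (Φ e' ∘ (Φ e).symm)
      ((Φ e).symm.trans (Φ e')).source) :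
    ∃ _ : SmoothMfd E, ∀ e,
      ContMDiffOn (SmoothMfd.I E) ((SmoothMfd.I M).prod (SmoothMfd.I F)) ∞ (Φ e) (Φ e).source ∧
      ContMDiffOn ((SmoothMfd.I M).prod (SmoothMfd.I F)) (SmoothMfd.I E) ∞
        (Φ e).symm (Φ e).target := by
  let c : E → OpenPartialHomeomorph E
      (EuclideanSpace ℝ (Fin (SmoothMfd.dim M + SmoothMfd.dim F))) :=
    fun e => (Φ e).trans (prodChart (Φ e e))
  have hc : ∀ e, e ∈ (c e).source := fun e => by
    simp only [c, OpenPartialHomeomorph.trans_source]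
    exact ⟨hmem e, mem_prodChart_source _⟩
  let cs : ChartedSpace (EuclideanSpace ℝ (Fin (SmoothMfd.dim M + SmoothMfd.dim F))) E :=
    { atlas := Set.range c
      chartAt := c
      mem_chart_source := hc
      chart_mem_atlas := fun e => ⟨e, rfl⟩ }
  have hm : IsManifold (𝓡 (SmoothMfd.dim M + SmoothMfd.dim F)) ∞ E := by
    refine isManifold_of_contDiffOn _ _ _ ?_
    rintro _ _ ⟨e, rfl⟩ ⟨e', rfl⟩
    rw [← contMDiffOn_iff_contDiffOn]
    have h1 : ContMDiffOn (𝓡 (SmoothMfd.dim M + SmoothMfd.dim F))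
        (𝓡 (SmoothMfd.dim M + SmoothMfd.dim F)) ∞
        (prodChart (Φ e' e') ∘ (Φ e' ∘ (Φ e).symm) ∘ (prodChart (Φ e e)).symm)
        ((c e).symm.trans (c e')).source := by
      refine (contMDiffOn_prodChart _).comp ((hcompat e e').comp
        ((contMDiffOn_prodChart_symm _).mono ?_) ?_) ?_
      · rintro x ⟨hx, -⟩
        exact hx.1
      · rintro x ⟨hx, hx'⟩
        exact ⟨hx.2, hx'.1⟩
      · rintro x ⟨hx, hx'⟩
        exact hx'.2
    refine h1.mono ?_
    rintro x ⟨hx, -⟩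
    exact hx
  let mf : SmoothMfd E :=
    { dim := SmoothMfd.dim M + SmoothMfd.dim F
      chartedSpace := cs
      isManifold := hm
      t2 := inferInstance
      secondCountable := inferInstance }
  refine ⟨mf, fun e => ⟨?_, ?_⟩⟩
  · intro x hx
    have hch : ContMDiffOn (𝓡 (SmoothMfd.dim M + SmoothMfd.dim F))
        (𝓡 (SmoothMfd.dim M + SmoothMfd.dim F)) ∞ (c x) (c x).source :=
      contMDiffOn_chart (H := EuclideanSpace ℝ (Fin (SmoothMfd.dim M + SmoothMfd.dim F)))
        (M := E) (x := x)
    have h1 := (hcompat x e).comp (((contMDiffOn_prodChart_symm (Φ x x)).comp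
        (hch.mono (t := (c x).source ∩ (Φ e).source) Set.inter_subset_left) ?_)) ?_
    · have h2 := h1.contMDiffAt (((c x).open_source.inter (Φ e).open_source).mem_nhds ⟨hc x, hx⟩)
      refine (h2.congr_of_eventuallyEq ?_).contMDiffWithinAt
      filter_upwards [((c x).open_source.inter (Φ e).open_source).mem_nhds ⟨hc x, hx⟩] with y hy
      have hy1 : y ∈ (Φ x).source := hy.1.1
      have hy2 : Φ x y ∈ (prodChart (Φ x x)).source := hy.1.2
      simp [c, hy1, hy2]
    · rintro y ⟨hy, -⟩
      exact ((c x).map_source hy).1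
    · rintro y ⟨hy, hy'⟩
      have hy1 : y ∈ (Φ x).source := hy.1
      have hy2 : Φ x y ∈ (prodChart (Φ x x)).source := hy.2
      simp [c, hy1, hy2, hy']
  · intro z hz
    set x := (Φ e).symm z with hxdef
    have hxs : x ∈ (Φ e).source := (Φ e).map_target hz
    have hch : ContMDiffOn (𝓡 (SmoothMfd.dim M + SmoothMfd.dim F))
        (𝓡 (SmoothMfd.dim M + SmoothMfd.dim F)) ∞ (c x).symm (c x).target :=
      contMDiffOn_chart_symm (H := EuclideanSpace ℝ (Fin (SmoothMfd.dim M + SmoothMfd.dim F)))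
        (M := E) (x := x)
    have hopen : IsOpen ((Φ e).target ∩ (Φ e).symm ⁻¹' (c x).source) :=
      (Φ e).isOpen_inter_preimage_symm (c x).open_source
    have h1 := hch.comp ((contMDiffOn_prodChart (Φ x x)).comp ((hcompat e x).mono
        (t := (Φ e).target ∩ (Φ e).symm ⁻¹' (c x).source) ?_) ?_) ?_
    · have h2 := h1.contMDiffAt (hopen.mem_nhds ⟨hz, hc x⟩)
      refine (h2.congr_of_eventuallyEq ?_).contMDiffWithinAt
      filter_upwards [hopen.mem_nhds ⟨hz, hc x⟩] with y hy
      exact ((c x).left_inv hy.2).symm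
    · rintro y ⟨hy, hy'⟩
      exact ⟨hy, hy'.1⟩
    · rintro y ⟨hy, hy'⟩
      exact hy'.2
    · rintro y ⟨hy, hy'⟩
      exact (c x).map_source hy'

end Gluing

/-! ### Principal bundles -/

section Principal

variable {X G M F : Type*} [TopologicalSpace X] [SmoothMfd X] [Group G] [TopologicalSpace G]
  [SmoothMfd G] [TopologicalSpace M] [SmoothMfd M] [TopologicalSpace F] [SmoothMfd F]
  {a : SmoothRightAction X G} {π : X → M}

theorem SmoothRightAction.act_act_inv (a : SmoothRightAction X G) (x : X) (g : G) :
    a.act (a.act x g) g⁻¹ = x := by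
  rw [← a.act_mul, mul_inv_cancel, a.act_one]

theorem SmoothRightAction.act_inv_of_eq (a : SmoothRightAction X G) {x y : X} {g : G}
    (h : a.act x g = y) : a.act y g⁻¹ = x := by
  rw [← h, a.act_act_inv]

theorem SmoothRightAction.continuous_act (a : SmoothRightAction X G) :
    Continuous fun z : X × G => a.act z.1 z.2 :=
  a.smooth.continuous

theorem IsPrincipalBundle.surjective {K : Subgroup G} (h : IsPrincipalBundle a K π) :
    Function.Surjective π := fun b => by
  obtain ⟨U, s, τ, -, hb, -, -, hs, -⟩ := h.locally_trivial b
  exact ⟨s b, hs b hb⟩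

/-- The structure group is transitive on the fibres. -/
theorem IsPrincipalBundle.exists_act {K : Subgroup G} (h : IsPrincipalBundle a K π) {x y : X}
    (hxy : π x = π y) : ∃ g ∈ K, a.act x g = y := by
  obtain ⟨U, s, τ, -, hb, -, -, -, hτ⟩ := h.locally_trivial (π x)
  obtain ⟨hx, hx'⟩ := hτ x hb
  obtain ⟨hy, hy'⟩ := hτ y (hxy ▸ hb)
  refine ⟨(τ x)⁻¹ * τ y, K.mul_mem (K.inv_mem hx) hy, ?_⟩
  rw [a.act_mul, a.act_inv_of_eq hx', hxy, hy']

theorem IsPrincipalBundle.act_injective (h : IsPrincipalBundle a ⊤ π) (x : X) :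
    Function.Injective (a.act x) := fun g k hgk => by
  have h1 : a.act x (g * k⁻¹) = x := by
    rw [a.act_mul, hgk, a.act_act_inv]
  exact mul_inv_eq_one.1 (h.free x _ trivial h1)

/-- Every smooth local section of a principal bundle gives a local trivialization, as two sections
differ by a smooth map to the structure group. -/
theorem IsPrincipalBundle.exists_coord [LieGroup (SmoothMfd.I G) ∞ G]
    (h : IsPrincipalBundle a ⊤ π) {U : Set M} {σ : M → X} (hU : IsOpen U)
    (hσ : ContMDiffOn (SmoothMfd.I M) (SmoothMfd.I X) ∞ σ U) (hπσ : ∀ u ∈ U, π (σ u) = u) :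
    ∃ τ : X → G, ContMDiffOn (SmoothMfd.I X) (SmoothMfd.I G) ∞ τ (π ⁻¹' U) ∧
      ∀ x, π x ∈ U → a.act (σ (π x)) (τ x) = x := by
  classical
  have hex : ∀ x, ∃ g, π x ∈ U → a.act (σ (π x)) g = x := fun x => by
    by_cases hx : π x ∈ U
    · obtain ⟨g, -, hg⟩ := h.exists_act (hπσ _ hx)
      exact ⟨g, fun _ => hg⟩
    · exact ⟨1, fun hx' => absurd hx' hx⟩
  choose τ hτ using hex
  refine ⟨τ, fun x hx => ?_, hτ⟩
  obtain ⟨U₀, s₀, τ₀, hU₀, hb, hs₀, hτ₀, hs₀', hτ₀'⟩ := h.locally_trivial (π x)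
  have hopen : IsOpen (π ⁻¹' (U ∩ U₀)) := (hU.inter hU₀).preimage h.smooth.continuous
  have h1 : ContMDiffOn (SmoothMfd.I X) (SmoothMfd.I G) ∞
      (fun y => (τ₀ (σ (π y)))⁻¹ * τ₀ y) (π ⁻¹' (U ∩ U₀)) := by
    refine ContMDiffOn.mul (ContMDiffOn.inv ?_) (hτ₀.mono fun y hy => hy.2)
    refine hτ₀.comp (hσ.comp h.smooth.contMDiffOn fun y hy => hy.1) fun y hy => ?_
    change π (σ (π y)) ∈ U₀
    rw [hπσ _ hy.1]
    exact hy.2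
  refine ((h1.contMDiffAt (hopen.mem_nhds ⟨hx, hb⟩)).congr_of_eventuallyEq ?_).contMDiffWithinAt
  filter_upwards [hopen.mem_nhds ⟨hx, hb⟩] with y hy
  refine h.act_injective (σ (π y)) ?_
  have h2 := (hτ₀' (σ (π y)) (by rw [hπσ _ hy.1]; exact hy.2)).2
  rw [hπσ _ hy.1] at h2
  rw [hτ y hy.1, a.act_mul, a.act_inv_of_eq h2, (hτ₀' y hy.2).2]

end Principal

/-! ### Associated bundles -/

/-- `E` is a bundle over `M` with fibre `F` associated with the principal `G`-bundle `π : X → M` by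
the action `l` of `G` on `F`. It is given by its projection `Q` and by the frames
`fr x : F → E`, the bijections from `F` to the fibre over `π x`, with `fr (x g) = fr x ∘ l g`. The
last field says that a local section `σ` of `X` gives a smooth local trivialization, whose inverse
is `(u, v) ↦ fr (σ u) v`. -/
structure IsAssocBundle {X G M F E : Type*} [TopologicalSpace X] [SmoothMfd X] [Group G]
    [TopologicalSpace G] [SmoothMfd G] [TopologicalSpace M] [SmoothMfd M]
    [TopologicalSpace F] [SmoothMfd F] [TopologicalSpace E] [SmoothMfd E]
    (a : SmoothRightAction X G) (π : X → M) (l : G → F → F) (Q : E → M) (fr : X → F → E) :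
    Prop where
  smooth_base : SmoothMap Q
  smooth_frame : SmoothMap₂ fun z : X × F => fr z.1 z.2
  base_frame : ∀ x v, Q (fr x v) = π x
  frame_act : ∀ x g v, fr (a.act x g) v = fr x (l g v)
  injective : ∀ x, Function.Injective (fr x)
  surjective : ∀ e, ∃ x v, fr x v = e
  coord : ∀ (U : Set M) (σ : M → X), IsOpen U →
    ContMDiffOn (SmoothMfd.I M) (SmoothMfd.I X) ∞ σ U → (∀ u ∈ U, π (σ u) = u) →
    ∃ t : E → F, ContMDiffOn (SmoothMfd.I E) (SmoothMfd.I F) ∞ t (Q ⁻¹' U) ∧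
      ∀ e, Q e ∈ U → fr (σ (Q e)) (t e) = e

section AssocExists

variable {X G M F : Type*} [TopologicalSpace X] [SmoothMfd X] [Group G] [TopologicalSpace G]
  [SmoothMfd G]
  {a : SmoothRightAction X G} {l : G → F → F}

theorem Assoc.mk_eq_mk_iff (hl1 : ∀ v, l 1 v = v) (hlm : ∀ g h v, l (g * h) v = l g (l h v))
    {x y : X} {v w : F} :
    Assoc.mk a.act l x v = Assoc.mk a.act l y w ↔ ∃ g : G, y = a.act x g ∧ w = l g⁻¹ v := by
  constructor
  · intro h
    have he : Equivalence (fun z w : X × F => ∃ g : G, w = (a.act z.1 g, l g⁻¹ z.2)) := by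
      refine ⟨fun z => ⟨1, ?_⟩, ?_, ?_⟩
      · rw [a.act_one, inv_one, hl1]
      · rintro z w ⟨g, rfl⟩
        refine ⟨g⁻¹, ?_⟩
        rw [a.act_act_inv, ← hlm, inv_inv, mul_inv_cancel, hl1]
      · rintro z w u ⟨g, rfl⟩ ⟨k, rfl⟩
        refine ⟨g * k, ?_⟩
        rw [a.act_mul, mul_inv_rev, hlm]
    obtain ⟨g, hg⟩ := he.eqvGen_iff.1 (Quot.eqvGen_exact h)
    exact ⟨g, (Prod.ext_iff.1 hg).1, (Prod.ext_iff.1 hg).2⟩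
  · rintro ⟨g, rfl, rfl⟩
    exact Quot.sound ⟨g, rfl⟩

theorem Assoc.mk_act (hl1 : ∀ v, l 1 v = v) (hlm : ∀ g h v, l (g * h) v = l g (l h v))
    (x : X) (g : G) (v : F) : Assoc.mk a.act l (a.act x g) v = Assoc.mk a.act l x (l g v) := by
  rw [eq_comm, Assoc.mk_eq_mk_iff hl1 hlm]
  refine ⟨g, rfl, ?_⟩
  rw [← hlm, inv_mul_cancel, hl1]

variable [TopologicalSpace M] [SmoothMfd M] {π : X → M}

theorem Assoc.mk_injective (h : IsPrincipalBundle a ⊤ π) (hl1 : ∀ v, l 1 v = v)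
    (hlm : ∀ g h v, l (g * h) v = l g (l h v)) (x : X) :
    Function.Injective (Assoc.mk a.act l x) := fun v w hvw => by
  obtain ⟨g, hg, rfl⟩ := (Assoc.mk_eq_mk_iff hl1 hlm).1 hvw
  rw [h.free x g trivial hg.symm, inv_one, hl1]

variable [TopologicalSpace F] [SmoothMfd F]

/-- The map `X × F → X ×_G F` is open, as the saturation of an open set is a union of
translates. -/
theorem Assoc.isOpenMap_mk (hl1 : ∀ v, l 1 v = v) (hlm : ∀ g h v, l (g * h) v = l g (l h v))
    (hl : SmoothMap₂ fun z : G × F => l z.1 z.2) :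
    IsOpenMap fun z : X × F => Assoc.mk a.act l z.1 z.2 := by
  intro W hW
  have hq : Topology.IsQuotientMap fun z : X × F => Assoc.mk a.act l z.1 z.2 :=
    isQuotientMap_quot_mk
  rw [← hq.isOpen_preimage]
  have : (fun z : X × F => Assoc.mk a.act l z.1 z.2) ⁻¹'
      ((fun z : X × F => Assoc.mk a.act l z.1 z.2) '' W) =
      ⋃ g : G, (fun z : X × F => (a.act z.1 g, l g⁻¹ z.2)) ⁻¹' W := by
    ext z
    simp only [Set.mem_preimage, Set.mem_image, Set.mem_iUnion]
    constructor
    · rintro ⟨w, hw, hwz⟩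
      obtain ⟨g, h1, h2⟩ := (Assoc.mk_eq_mk_iff hl1 hlm).1 hwz.symm
      refine ⟨g, ?_⟩
      rw [← h1, ← h2]
      exact hw
    · rintro ⟨g, hg⟩
      exact ⟨_, hg, ((Assoc.mk_eq_mk_iff hl1 hlm).2 ⟨g, rfl, rfl⟩).symm⟩
  rw [this]
  refine isOpen_iUnion fun g => hW.preimage ?_
  exact (a.continuous_act.comp (continuous_fst.prodMk continuous_const)).prodMk
    (hl.continuous.comp (continuous_const.prodMk continuous_snd))

/-- The space associated with a principal bundle is a smooth manifold, and an associated bundle with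
the frames `v ↦ [x, v]`. -/
theorem IsPrincipalBundle.exists_isAssocBundle [LieGroup (SmoothMfd.I G) ∞ G]
    (h : IsPrincipalBundle a ⊤ π) (hl1 : ∀ v, l 1 v = v)
    (hlm : ∀ g h v, l (g * h) v = l g (l h v)) (hl : SmoothMap₂ fun z : G × F => l z.1 z.2) :
    ∃ (_ : SmoothMfd (Assoc a.act l)) (Q : Assoc a.act l → M),
      IsAssocBundle a π l Q (Assoc.mk a.act l) := by
  classical
  set mk := Assoc.mk a.act l with hmk
  have hq : Topology.IsQuotientMap fun z : X × F => mk z.1 z.2 := isQuotientMap_quot_mk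
  have hopen : IsOpenMap fun z : X × F => mk z.1 z.2 := Assoc.isOpenMap_mk hl1 hlm hl
  have hsurj : ∀ e : Assoc a.act l, ∃ x v, mk x v = e := fun e => by
    obtain ⟨z, rfl⟩ := hq.surjective e
    exact ⟨z.1, z.2, rfl⟩
  have hact : ∀ x g v, mk (a.act x g) v = mk x (l g v) := Assoc.mk_act hl1 hlm
  have hinj : ∀ x, Function.Injective (mk x) := Assoc.mk_injective h hl1 hlm
  let Q : Assoc a.act l → M := Quot.lift (fun z => π z.1) (by
    rintro z _ ⟨g, rfl⟩
    exact (h.invariant z.1 g trivial).symm)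
  have hQ : ∀ x v, Q (mk x v) = π x := fun x v => rfl
  have hQc : Continuous Q := hq.continuous_iff.2 (h.smooth.continuous.comp continuous_fst)
  have hlx : ∀ {τ : X → G} {U : Set M},
      ContMDiffOn (SmoothMfd.I X) (SmoothMfd.I G) ∞ τ (π ⁻¹' U) →
      ContMDiffOn ((SmoothMfd.I X).prod (SmoothMfd.I F)) (SmoothMfd.I F) ∞
        (fun z : X × F => l (τ z.1) z.2) ((fun z : X × F => z.1) ⁻¹' (π ⁻¹' U)) := by
    intro τ U hτ
    exact hl.comp_contMDiffOn ((hτ.comp contMDiff_fst.contMDiffOn fun z hz => hz).prodMk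
      contMDiff_snd.contMDiffOn)
  -- the fibre coordinate of a local trivialization of the principal bundle
  let t : (X → G) → Assoc a.act l → F := fun τ e => l (τ e.out.1) e.out.2
  have hout : ∀ e : Assoc a.act l, mk e.out.1 e.out.2 = e := fun e => Quot.out_eq e
  have hmt : ∀ {U : Set M} {σ : M → X} {τ : X → G},
      (∀ x, π x ∈ U → a.act (σ (π x)) (τ x) = x) →
      ∀ e, Q e ∈ U → mk (σ (Q e)) (t τ e) = e := by
    intro U σ τ hτ e he
    have hπ : Q e = π e.out.1 := by rw [← hQ e.out.1 e.out.2, hout]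
    have h1 : mk (σ (Q e)) (t τ e) = mk (a.act (σ (Q e)) (τ e.out.1)) e.out.2 := (hact _ _ _).symm
    rw [h1, hπ, hτ _ (hπ ▸ he), hout]
  have ht : ∀ {U : Set M} {σ : M → X} {τ : X → G},
      (∀ x, π x ∈ U → a.act (σ (π x)) (τ x) = x) →
      ∀ x v, π x ∈ U → t τ (mk x v) = l (τ x) v := by
    intro U σ τ hτ x v hx
    refine hinj (σ (π x)) ?_
    have h1 := hmt hτ (mk x v) hx
    rw [hQ] at h1
    rw [h1, ← hact, hτ x hx]
  have htc : ∀ {U : Set M} {σ : M → X} {τ : X → G}, IsOpen U →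
      ContMDiffOn (SmoothMfd.I X) (SmoothMfd.I G) ∞ τ (π ⁻¹' U) →
      (∀ x, π x ∈ U → a.act (σ (π x)) (τ x) = x) → ContinuousOn (t τ) (Q ⁻¹' U) := by
    intro U σ τ hU hτs hτ
    rw [hq.continuousOn_isOpen_iff (hU.preimage hQc)]
    exact (hlx hτs).continuousOn.congr fun z hz => ht hτ z.1 z.2 hz
  choose U σ τ hU hbU hσ hτs hπσ hτ using h.locally_trivial
  have hτ' : ∀ b x, π x ∈ U b → a.act (σ b (π x)) (τ b x) = x := fun b x hx => (hτ b x hx).2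
  have hts : ∀ b u v, u ∈ U b → t (τ b) (mk (σ b u) v) = v := fun b u v hu => by
    refine hinj (σ b u) ?_
    have h1 := hmt (hτ' b) (mk (σ b u) v) (by rw [hQ, hπσ b u hu]; exact hu)
    rwa [hQ, hπσ b u hu] at h1
  have : T2Space (Assoc a.act l) := by
    refine ⟨fun e e' hne => ?_⟩
    by_cases hee : Q e = Q e'
    · set b := Q e
      have hcont := htc (hU b) (hτs b) (hτ' b)
      have hne' : t (τ b) e ≠ t (τ b) e' := fun hte => hne (by
        rw [← hmt (hτ' b) e (hbU b), ← hmt (hτ' b) e' (hee ▸ hbU b), ← hee, hte])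
      obtain ⟨A, B, hA, hB, heA, heB, hAB⟩ := t2_separation hne'
      refine ⟨_, _, hcont.isOpen_inter_preimage ((hU b).preimage hQc) hA,
        hcont.isOpen_inter_preimage ((hU b).preimage hQc) hB, ⟨hbU b, heA⟩,
        ⟨by rw [Set.mem_preimage, ← hee]; exact hbU b, heB⟩, ?_⟩
      exact Set.disjoint_left.2 fun y hy hy' => Set.disjoint_left.1 hAB hy.2 hy'.2
    · obtain ⟨A, B, hA, hB, heA, heB, hAB⟩ := t2_separation hee
      exact ⟨_, _, hA.preimage hQc, hB.preimage hQc, heA, heB, hAB.preimage Q⟩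
  have : SecondCountableTopology (Assoc a.act l) := hq.secondCountableTopology hopen
  have hms : ∀ b, ContMDiffOn ((SmoothMfd.I M).prod (SmoothMfd.I F))
      ((SmoothMfd.I X).prod (SmoothMfd.I F)) ∞ (fun z : M × F => (σ b z.1, z.2))
      (U b ×ˢ Set.univ) := fun b =>
    ((hσ b).comp contMDiff_fst.contMDiffOn fun z hz => hz.1).prodMk contMDiff_snd.contMDiffOn
  let Φ : M → OpenPartialHomeomorph (Assoc a.act l) (M × F) := fun b =>
    { toFun := fun e => (Q e, t (τ b) e)
      invFun := fun z => mk (σ b z.1) z.2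
      source := Q ⁻¹' U b
      target := U b ×ˢ Set.univ
      map_source' := fun e he => ⟨he, trivial⟩
      map_target' := fun z hz => by
        change Q (mk (σ b z.1) z.2) ∈ U b
        rw [hQ, hπσ b _ hz.1]; exact hz.1
      left_inv' := fun e he => hmt (hτ' b) e he
      right_inv' := fun z hz => by
        refine Prod.ext ?_ (hts b _ _ hz.1)
        change Q (mk (σ b z.1) z.2) = z.1
        rw [hQ, hπσ b _ hz.1]
      open_source := (hU b).preimage hQc
      open_target := (hU b).prod isOpen_univ
      continuousOn_toFun := hQc.continuousOn.prodMk (htc (hU b) (hτs b) (hτ' b))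
      continuousOn_invFun := hq.continuous.comp_continuousOn (hms b).continuousOn }
  have hΦsymm : ∀ b z, (Φ b).symm z = mk (σ b z.1) z.2 := fun b z => rfl
  have hΦ : ∀ b e, Φ b e = (Q e, t (τ b) e) := fun b e => rfl
  obtain ⟨mf, hmf⟩ := exists_smoothMfd_of_local_prod (fun e => Φ (Q e)) (fun e => hbU (Q e)) (by
    intro e e'
    have h1 : ContMDiffOn ((SmoothMfd.I M).prod (SmoothMfd.I F))
        ((SmoothMfd.I M).prod (SmoothMfd.I F)) ∞
        (fun z : M × F => (z.1, l (τ (Q e') (σ (Q e) z.1)) z.2))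
        ((Φ (Q e)).symm.trans (Φ (Q e'))).source := by
      refine contMDiff_fst.contMDiffOn.prodMk ((hlx (hτs (Q e'))).comp
        ((hms (Q e)).mono fun z hz => hz.1) ?_)
      rintro z ⟨hz, hz'⟩
      exact hz'
    refine h1.congr fun z hz => ?_
    have hz2 : Q (mk (σ (Q e) z.1) z.2) ∈ U (Q e') := hz.2
    refine Prod.ext ?_ (ht (hτ' (Q e')) _ _ hz2)
    exact hπσ (Q e) _ hz.1.1)
  have hQs : SmoothMap Q := fun e => by
    have h1 := (contMDiff_fst (I := SmoothMfd.I M) (J := SmoothMfd.I F) (n := ∞)).comp_contMDiffOn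
      (hmf e).1
    exact h1.contMDiffAt ((Φ (Q e)).open_source.mem_nhds (hbU (Q e)))
  refine ⟨mf, Q, hQs, ?_, hQ, hact, hinj, hsurj, ?_⟩
  · intro z
    have h1 : ContMDiffOn ((SmoothMfd.I X).prod (SmoothMfd.I F)) (SmoothMfd.I (Assoc a.act l)) ∞
        ((Φ (π z.1)).symm ∘ fun w : X × F => (π w.1, l (τ (π z.1) w.1) w.2))
        ((fun w : X × F => w.1) ⁻¹' (π ⁻¹' U (π z.1))) := by
      refine (hmf (mk z.1 z.2)).2.comp
        ((h.smooth.comp contMDiff_fst).contMDiffOn.prodMk (hlx (hτs (π z.1)))) ?_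
      intro w hw
      exact ⟨hw, trivial⟩
    have hn : (fun w : X × F => w.1) ⁻¹' (π ⁻¹' U (π z.1)) ∈ 𝓝 z :=
      (((hU _).preimage h.smooth.continuous).preimage continuous_fst).mem_nhds (hbU _)
    refine (h1.contMDiffAt hn).congr_of_eventuallyEq ?_
    filter_upwards [hn] with w hw
    change mk w.1 w.2 = mk (σ (π z.1) (π w.1)) (l (τ (π z.1) w.1) w.2)
    rw [← hact, hτ' _ _ hw]
  · intro U' σ' hU' hσ' hπσ'
    obtain ⟨τ', hτ's, hστ'⟩ := h.exists_coord hU' hσ' hπσ'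
    refine ⟨t τ', fun e he => ?_, hmt hστ'⟩
    have h1 : ContMDiffOn (SmoothMfd.I (Assoc a.act l)) (SmoothMfd.I F) ∞
        ((fun z : X × F => l (τ' z.1) z.2) ∘ (fun z : M × F => (σ (Q e) z.1, z.2)) ∘ Φ (Q e))
        (Q ⁻¹' (U' ∩ U (Q e))) := by
      refine (hlx hτ's).comp ((hms (Q e)).comp ((hmf e).1.mono fun y hy => hy.2) ?_) ?_
      · intro y hy
        exact ⟨hy.2, trivial⟩
      · intro y hy
        change π (σ (Q e) (Q y)) ∈ U'
        rw [hπσ (Q e) _ hy.2]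
        exact hy.1
    have hn : Q ⁻¹' (U' ∩ U (Q e)) ∈ 𝓝 e :=
      ((hU'.inter (hU _)).preimage hQc).mem_nhds ⟨he, hbU _⟩
    refine ((h1.contMDiffAt hn).congr_of_eventuallyEq ?_).contMDiffWithinAt
    filter_upwards [hn] with y hy
    have h2 := hmt (hτ' (Q e)) y hy.2
    have h3 := ht hστ' (σ (Q e) (Q y)) (t (τ (Q e)) y) (by rw [hπσ (Q e) _ hy.2]; exact hy.1)
    rw [h2] at h3
    exact h3

end AssocExists

/-! ### Embeddings and local retractions -/

section VectorBundleMaps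

variable {X B : Type*} [TopologicalSpace X] [SmoothMfd X] [TopologicalSpace B] [SmoothMfd B]

theorem SmoothVB.smooth_proj (A : SmoothVB X B) : SmoothMap A.proj := fun x => by
  obtain ⟨e, hb, he, -⟩ := A.locally_trivial (A.proj x)
  have hx : e.source ∈ 𝓝 x := e.open_source.mem_nhds (e.mem_source.2 hb)
  have h1 := (contMDiff_fst (I := SmoothMfd.I B) (J := 𝓡 A.rank) (n := ∞)).comp_contMDiffOn he
  refine (h1.contMDiffAt hx).congr_of_eventuallyEq ?_
  filter_upwards [hx] with y hy
  exact (e.proj_toFun y hy).symm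

end VectorBundleMaps

/-- A map which has smooth left inverses near each point of its image. -/
def HasLocalRetractions {F F' : Type*} [TopologicalSpace F] [SmoothMfd F] [TopologicalSpace F']
    [SmoothMfd F'] (f : F → F') : Prop :=
  ∀ v, ∃ (W : Set F') (r : F' → F), IsOpen W ∧ f v ∈ W ∧
    ContMDiffOn (SmoothMfd.I F') (SmoothMfd.I F) ∞ r W ∧ ∀ w, f w ∈ W → r (f w) = w

theorem HasLocalRetractions.isSmoothEmb {F F' : Type*} [TopologicalSpace F] [SmoothMfd F]
    [TopologicalSpace F'] [SmoothMfd F'] {f : F → F'} (hf : SmoothMap f)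
    (h : HasLocalRetractions f) : IsSmoothEmb f := by
  refine ⟨hf, ⟨?_, ?_⟩, ?_⟩
  · rw [Topology.isInducing_iff_nhds]
    refine fun v => le_antisymm hf.continuous.continuousAt.le_comap ?_
    obtain ⟨W, r, hW, hv, hr, hrf⟩ := h v
    have hc : Filter.Tendsto r (𝓝 (f v)) (𝓝 v) := by
      have := (hr.continuousOn.continuousAt (hW.mem_nhds hv)).tendsto
      rwa [hrf v hv] at this
    have h1 : Filter.Tendsto (fun w => r (f w)) (Filter.comap f (𝓝 (f v))) (𝓝 v) :=
      hc.comp Filter.tendsto_comap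
    have h2 : (fun w => r (f w)) =ᶠ[Filter.comap f (𝓝 (f v))] id := by
      filter_upwards [Filter.preimage_mem_comap (hW.mem_nhds hv)] with w hw
      exact hrf w hw
    exact (Filter.tendsto_congr' h2).1 h1
  · intro v w hvw
    obtain ⟨W, r, hW, hv, hr, hrf⟩ := h v
    rw [← hrf v hv, ← hrf w (hvw ▸ hv), hvw]
  · intro v
    obtain ⟨W, r, hW, hv, hr, hrf⟩ := h v
    have hr' := ((hr.contMDiffAt (hW.mem_nhds hv)).mdifferentiableAt (by simp))
    have hf' := (hf v).mdifferentiableAt (by simp : (∞ : ℕ∞ω) ≠ 0)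
    have h1 := mfderiv_comp v hr' hf'
    have h2 : r ∘ f =ᶠ[𝓝 v] id := by
      filter_upwards [(hW.preimage hf.continuous).mem_nhds hv] with w hw
      exact hrf w hw
    rw [h2.mfderiv_eq, mfderiv_id] at h1
    refine Function.LeftInverse.injective (g := mfderiv (SmoothMfd.I F') (SmoothMfd.I F) r (f v)) ?_
    intro z
    exact (DFunLike.congr_fun h1 z).symm

/-! ### Structures on associated bundles -/

section Transfer

variable {X G M : Type*} [TopologicalSpace X] [SmoothMfd X] [Group G]
  [TopologicalSpace G] [SmoothMfd G] [TopologicalSpace M] [SmoothMfd M]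
  {a : SmoothRightAction X G} {π : X → M}
  {F E : Type*} [TopologicalSpace F] [SmoothMfd F] [TopologicalSpace E] [SmoothMfd E]
  {l : G → F → F} {Q : E → M} {fr : X → F → E}
  {F' E' : Type*} [TopologicalSpace F'] [SmoothMfd F'] [TopologicalSpace E'] [SmoothMfd E']
  {l' : G → F' → F'} {Q' : E' → M} {fr' : X → F' → E'}

theorem IsAssocBundle.exists_frame_eq (H : IsAssocBundle a π l Q fr)
    (h : IsPrincipalBundle a ⊤ π) {x : X} {e : E} (he : Q e = π x) : ∃ v, fr x v = e := by
  obtain ⟨y, w, rfl⟩ := H.surjective e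
  rw [H.base_frame] at he
  obtain ⟨g, -, rfl⟩ := h.exists_act he.symm
  exact ⟨l g w, (H.frame_act _ _ _).symm⟩

theorem IsAssocBundle.act_eq_of_frame_eq (H : IsAssocBundle a π l Q fr)
    (h : IsPrincipalBundle a ⊤ π) {x y : X} {v w : F} (he : fr y w = fr x v) :
    ∃ g, y = a.act x g ∧ l g w = v := by
  have hxy : π x = π y := by rw [← H.base_frame x v, ← he, H.base_frame]
  obtain ⟨g, -, rfl⟩ := h.exists_act hxy
  rw [H.frame_act] at he
  exact ⟨g, rfl, H.injective _ he⟩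

theorem IsAssocBundle.coord_frame (H : IsAssocBundle a π l Q fr) {U : Set M} {σ : M → X}
    {t : E → F} (hσ : ∀ u ∈ U, π (σ u) = u) (ht : ∀ e, Q e ∈ U → fr (σ (Q e)) (t e) = e)
    {u : M} (hu : u ∈ U) (v : F) : t (fr (σ u) v) = v := by
  have hQ : Q (fr (σ u) v) = u := by rw [H.base_frame, hσ u hu]
  have h1 := ht (fr (σ u) v) (by rw [hQ]; exact hu)
  rw [hQ] at h1
  exact H.injective _ h1

/-- An equivariant map of the fibres induces a map of the associated bundles. -/
theorem IsAssocBundle.exists_map (H : IsAssocBundle a π l Q fr) (H' : IsAssocBundle a π l' Q' fr')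
    (h : IsPrincipalBundle a ⊤ π) {f₀ : F → F'} (hf₀ : ∀ g v, f₀ (l g v) = l' g (f₀ v)) :
    ∃ f : E → E', ∀ x v, f (fr x v) = fr' x (f₀ v) := by
  choose xE vE hE using H.surjective
  refine ⟨fun e => fr' (xE e) (f₀ (vE e)), fun x v => ?_⟩
  obtain ⟨g, h1, h2⟩ := H.act_eq_of_frame_eq h (hE (fr x v))
  change fr' (xE (fr x v)) (f₀ (vE (fr x v))) = _
  rw [h1, H'.frame_act, ← hf₀, h2]

/-- An equivariant partially defined operation on the fibre induces one on the associated
bundle. -/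
theorem IsAssocBundle.exists_map₂ (H : IsAssocBundle a π l Q fr) (h : IsPrincipalBundle a ⊤ π)
    {R : F → F → Prop} {op : F → F → F}
    (hop : ∀ g v w, R v w → op (l g v) (l g w) = l g (op v w)) :
    ∃ f : E → E → E, ∀ x v w, R v w → f (fr x v) (fr x w) = fr x (op v w) := by
  classical
  have hex : ∀ e e', ∃ e'', ∀ x v w, R v w → fr x v = e → fr x w = e' → fr x (op v w) = e'' := by
    intro e e'
    by_cases hee : ∃ x v w, R v w ∧ fr x v = e ∧ fr x w = e'
    · obtain ⟨x, v, w, hvw, rfl, rfl⟩ := hee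
      refine ⟨fr x (op v w), fun y v' w' hvw' h1 h2 => ?_⟩
      obtain ⟨g, rfl, h3⟩ := H.act_eq_of_frame_eq h h1
      rw [H.frame_act] at h2 ⊢
      rw [← hop _ _ _ hvw', h3, H.injective _ h2]
    · exact ⟨e, fun x v w h1 h2 h3 => (hee ⟨x, v, w, h1, h2, h3⟩).elim⟩
  choose f hf using hex
  exact ⟨f, fun x v w hvw => (hf _ _ x v w hvw rfl rfl).symm⟩

/-- A map which is given by one and the same smooth map in all frames is smooth. -/
theorem IsAssocBundle.smoothMap (H : IsAssocBundle a π l Q fr)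
    (H' : IsAssocBundle a π l' Q' fr') (h : IsPrincipalBundle a ⊤ π) {f : E → E'} {f₀ : F → F'}
    (hf₀ : SmoothMap f₀) (hf : ∀ x v, f (fr x v) = fr' x (f₀ v)) : SmoothMap f := fun e => by
  obtain ⟨U, σ, -, hU, hb, hσ, -, hπσ, -⟩ := h.locally_trivial (Q e)
  obtain ⟨t, ht, hfr⟩ := H.coord U σ hU hσ hπσ
  have h1 : ContMDiffOn (SmoothMfd.I E) (SmoothMfd.I E') ∞
      (fun y => fr' (σ (Q y)) (f₀ (t y))) (Q ⁻¹' U) :=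
    H'.smooth_frame.comp_contMDiffOn ((hσ.comp H.smooth_base.contMDiffOn fun y hy => hy).prodMk
      (hf₀.comp_contMDiffOn ht))
  have hn : Q ⁻¹' U ∈ 𝓝 e := (hU.preimage H.smooth_base.continuous).mem_nhds hb
  refine (h1.contMDiffAt hn).congr_of_eventuallyEq ?_
  filter_upwards [hn] with y hy
  rw [← hf, hfr y hy]

theorem IsAssocBundle.hasLocalRetractions (H : IsAssocBundle a π l Q fr)
    (H' : IsAssocBundle a π l' Q' fr') (h : IsPrincipalBundle a ⊤ π) {f : E → E'} {f₀ : F → F'}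
    (hf₀ : HasLocalRetractions f₀) (hf : ∀ x v, f (fr x v) = fr' x (f₀ v)) :
    HasLocalRetractions f := fun e => by
  obtain ⟨U, σ, -, hU, hb, hσ, -, hπσ, -⟩ := h.locally_trivial (Q e)
  obtain ⟨t, ht, hfr⟩ := H.coord U σ hU hσ hπσ
  obtain ⟨t', ht', hfr'⟩ := H'.coord U σ hU hσ hπσ
  obtain ⟨W, r, hW, hv, hr, hrf⟩ := hf₀ (t e)
  have hQ : ∀ y, Q' (f y) = Q y := fun y => by
    obtain ⟨x, v, rfl⟩ := H.surjective y
    rw [hf, H'.base_frame, H.base_frame]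
  have htf : ∀ y, Q y ∈ U → t' (f y) = f₀ (t y) := fun y hy => by
    conv_lhs => rw [← hfr y hy, hf]
    exact H'.coord_frame hπσ hfr' hy _
  refine ⟨Q' ⁻¹' U ∩ t' ⁻¹' W, fun y => fr (σ (Q' y)) (r (t' y)), ?_, ⟨?_, ?_⟩, ?_, ?_⟩
  · exact ht'.continuousOn.isOpen_inter_preimage (hU.preimage H'.smooth_base.continuous) hW
  · rw [Set.mem_preimage, hQ]
    exact hb
  · rw [Set.mem_preimage, htf e hb]
    exact hv
  · refine H.smooth_frame.comp_contMDiffOn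
      ((hσ.comp H'.smooth_base.contMDiffOn fun y hy => hy.1).prodMk
        (hr.comp (ht'.mono fun y hy => hy.1) fun y hy => hy.2))
  · rintro y ⟨hy1, hy2⟩
    rw [Set.mem_preimage, hQ] at hy1
    rw [Set.mem_preimage, htf y hy1] at hy2
    change fr (σ (Q' (f y))) (r (t' (f y))) = y
    rw [htf y hy1, hrf _ hy2, hQ, hfr y hy1]

theorem IsAssocBundle.isSmoothSubmersion₂ (H : IsAssocBundle a π l Q fr)
    (h : IsPrincipalBundle a ⊤ π) (hl1 : ∀ v, l 1 v = v)
    (hlm : ∀ g h v, l (g * h) v = l g (l h v)) (hl : SmoothMap₂ fun z : G × F => l z.1 z.2) :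
    IsSmoothSubmersion₂ fun z : X × F => fr z.1 z.2 := by
  refine ⟨H.smooth_frame, fun z => ?_⟩
  obtain ⟨U, σ, -, hU, hb, hσ, -, hπσ, -⟩ := h.locally_trivial (π z.1)
  obtain ⟨t, ht, hfr⟩ := H.coord U σ hU hσ hπσ
  obtain ⟨g, -, hg⟩ := h.exists_act (hπσ _ hb)
  have hQ : Q (fr z.1 z.2) = π z.1 := H.base_frame _ _
  -- a smooth local section of the frame map through `z`
  let S : E → X × F := fun e => (a.act (σ (Q e)) g, l g⁻¹ (t e))
  have hS : ContMDiffOn (SmoothMfd.I E) ((SmoothMfd.I X).prod (SmoothMfd.I F)) ∞ S (Q ⁻¹' U) :=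
    (a.smooth.comp_contMDiffOn ((hσ.comp H.smooth_base.contMDiffOn fun y hy => hy).prodMk
      contMDiffOn_const)).prodMk (hl.comp_contMDiffOn (contMDiffOn_const.prodMk ht))
  have hSfr : ∀ e, Q e ∈ U → fr (S e).1 (S e).2 = e := fun e he => by
    change fr (a.act (σ (Q e)) g) (l g⁻¹ (t e)) = e
    rw [H.frame_act, ← hlm, mul_inv_cancel, hl1, hfr e he]
  have hSz : S (fr z.1 z.2) = z := by
    have h1 : (S (fr z.1 z.2)).1 = z.1 := by
      change a.act (σ (Q (fr z.1 z.2))) g = z.1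
      rw [hQ, hg]
    refine Prod.ext h1 (H.injective z.1 ?_)
    have h2 := hSfr (fr z.1 z.2) (by rw [hQ]; exact hb)
    rwa [h1] at h2
  have hn : Q ⁻¹' U ∈ 𝓝 (fr z.1 z.2) :=
    (hU.preimage H.smooth_base.continuous).mem_nhds (by rw [Set.mem_preimage, hQ]; exact hb)
  have hS' := (hS.contMDiffAt hn).mdifferentiableAt (by simp)
  have hF : MDifferentiableAt ((SmoothMfd.I X).prod (SmoothMfd.I F)) (SmoothMfd.I E)
      (fun z : X × F => fr z.1 z.2) (S (fr z.1 z.2)) :=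
    (H.smooth_frame _).mdifferentiableAt (by simp)
  have h1 := mfderiv_comp (fr z.1 z.2) hF hS'
  have h2 : (fun z : X × F => fr z.1 z.2) ∘ S =ᶠ[𝓝 (fr z.1 z.2)] id := by
    filter_upwards [hn] with e he
    exact hSfr e he
  rw [h2.mfderiv_eq, mfderiv_id, hSz] at h1
  intro y
  exact ⟨mfderiv _ _ S (fr z.1 z.2) y, (DFunLike.congr_fun h1 y).symm⟩

/-- An associated bundle of a principal bundle `X₁` is associated with any principal bundle `X`
which has a homomorphism to `X₁`. -/
theorem IsAssocBundle.comp {X₁ G₁ : Type*} [TopologicalSpace X₁] [SmoothMfd X₁] [Group G₁]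
    [TopologicalSpace G₁] [SmoothMfd G₁] {a₁ : SmoothRightAction X₁ G₁} {π₁ : X₁ → M}
    {l : G₁ → F → F} {fr : X₁ → F → E} (H : IsAssocBundle a₁ π₁ l Q fr) {p : X → X₁}
    (hp : SmoothMap p) (hps : Function.Surjective p) (φ : G → G₁) (hπ : ∀ x, π₁ (p x) = π x)
    (hact : ∀ x g, p (a.act x g) = a₁.act (p x) (φ g)) :
    IsAssocBundle a π (fun g => l (φ g)) Q (fun x => fr (p x)) where
  smooth_base := H.smooth_base
  smooth_frame := H.smooth_frame.comp ((hp.comp contMDiff_fst).prodMk contMDiff_snd)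
  base_frame x v := by rw [H.base_frame, hπ]
  frame_act x g v := by rw [hact, H.frame_act]
  injective x := H.injective _
  surjective e := by
    obtain ⟨x₁, v, rfl⟩ := H.surjective e
    obtain ⟨x, rfl⟩ := hps x₁
    exact ⟨x, v, rfl⟩
  coord U σ hU hσ hπσ :=
    H.coord U (fun u => p (σ u)) hU (hp.comp_contMDiffOn hσ) fun u hu => by rw [hπ, hπσ u hu]

/-- The base is the associated bundle whose fibre is a point. -/
theorem IsPrincipalBundle.isAssocBundle_base (h : IsPrincipalBundle a ⊤ π) :
    IsAssocBundle a π (fun _ (u : Unit) => u) id (fun x (_ : Unit) => π x) where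
  smooth_base := contMDiff_id
  smooth_frame := h.smooth.comp contMDiff_fst
  base_frame x v := rfl
  frame_act x g v := h.invariant x g trivial
  injective x := fun _ _ _ => rfl
  surjective m := by
    obtain ⟨x, hx⟩ := h.surjective m
    exact ⟨x, (), hx⟩
  coord U σ hU hσ hπσ := ⟨fun _ => (), contMDiffOn_const, fun m hm => hπσ m hm⟩

/-- The vector bundle structure `A'` on `E → E'` is in all frames given by the vector bundle
structure `A` on the fibres `F → F'`. -/
structure IsAssocVB (A : SmoothVB F F') (A' : SmoothVB E E') (fr : X → F → E)
    (fr' : X → F' → E') : Prop where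
  proj : ∀ x v, A'.proj (fr x v) = fr' x (A.proj v)
  zero : ∀ x v, A'.zero (fr' x v) = fr x (A.zero v)
  add : ∀ x v w, A.proj v = A.proj w → A'.add (fr x v) (fr x w) = fr x (A.add v w)
  smul : ∀ (r : ℝ) x v, A'.smul r (fr x v) = fr x (A.smul r v)

/-- A vector bundle with an action of the structure group by automorphisms induces a vector bundle
of associated bundles. Over the domain of a local section the latter is the product of
an open subset of `M` with the former, which provides the local trivializations. -/
theorem IsAssocBundle.exists_smoothVB (H : IsAssocBundle a π l Q fr)
    (H' : IsAssocBundle a π l' Q' fr') (h : IsPrincipalBundle a ⊤ π) (A : SmoothVB F F')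
    (hA : ∀ g, IsVBHom A A (l g) (l' g)) :
    ∃ A' : SmoothVB E E', IsAssocVB A A' fr fr' := by
  obtain ⟨proj, hproj⟩ := H.exists_map H' h (f₀ := A.proj) fun g v => (hA g).proj v
  obtain ⟨zero, hzero⟩ := H'.exists_map H h (f₀ := A.zero) fun g v => ((hA g).map_zero v).symm
  have hsmul := fun r : ℝ =>
    H.exists_map H h (f₀ := A.smul r) fun g v => ((hA g).smul r v).symm
  choose smul hsmul using hsmul
  obtain ⟨add, hadd⟩ := H.exists_map₂ h (R := fun v w => A.proj v = A.proj w) (op := A.add)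
    (fun g v w hvw => ((hA g).add v w hvw).symm)
  have hprojs : SmoothMap proj := H.smoothMap H' h A.smooth_proj hproj
  have hQproj : ∀ e, Q' (proj e) = Q e := fun e => by
    obtain ⟨x, v, rfl⟩ := H.surjective e
    rw [hproj, H'.base_frame, H.base_frame]
  have hpair : ∀ e₁ e₂, proj e₁ = proj e₂ → ∃ x v w, e₁ = fr x v ∧ e₂ = fr x w ∧
      A.proj v = A.proj w := by
    intro e₁ e₂ he
    obtain ⟨x, v, rfl⟩ := H.surjective e₁
    obtain ⟨w, rfl⟩ := H.exists_frame_eq h (x := x) (e := e₂) (by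
      rw [← hQproj, ← he, hQproj, H.base_frame])
    rw [hproj, hproj] at he
    exact ⟨x, v, w, rfl, rfl, H'.injective _ he⟩
  refine ⟨⟨proj, zero, add, smul, A.rank, ?_, ?_, ?_, ?_⟩, hproj, hzero, hadd, hsmul⟩
  · intro e'
    obtain ⟨x, v, rfl⟩ := H'.surjective e'
    rw [hzero, hproj, A.proj_zero]
  · intro e₁ e₂ he
    obtain ⟨x, v, w, rfl, rfl, hvw⟩ := hpair e₁ e₂ he
    rw [hadd _ _ _ hvw, hproj, hproj, A.proj_add _ _ hvw]
  · intro r e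
    obtain ⟨x, v, rfl⟩ := H.surjective e
    rw [hsmul, hproj, hproj, A.proj_smul]
  · intro e'
    obtain ⟨U, σ, -, hU, hb, hσ, -, hπσ, -⟩ := h.locally_trivial (Q' e')
    obtain ⟨t, hts, ht⟩ := H.coord U σ hU hσ hπσ
    obtain ⟨t', hts', ht'⟩ := H'.coord U σ hU hσ hπσ
    obtain ⟨e₀, he₀, hs, hs', h0, ha, hm⟩ := A.locally_trivial (t' e')
    have htt : ∀ e, Q e ∈ U → t' (proj e) = A.proj (t e) := fun e he => by
      conv_lhs => rw [← ht e he, hproj]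
      exact H'.coord_frame hπσ ht' he _
    have htf : ∀ u ∈ U, ∀ v, t (fr (σ u) v) = v := fun u hu v => H.coord_frame hπσ ht hu v
    have hB : IsOpen (Q' ⁻¹' U ∩ t' ⁻¹' e₀.baseSet) :=
      hts'.continuousOn.isOpen_inter_preimage (hU.preimage H'.smooth_base.continuous)
        e₀.open_baseSet
    have hQU : ∀ e, proj e ∈ Q' ⁻¹' U ∩ t' ⁻¹' e₀.baseSet → Q e ∈ U := fun e he => by
      rw [← hQproj]
      exact he.1
    have hsrc : ∀ e, proj e ∈ Q' ⁻¹' U ∩ t' ⁻¹' e₀.baseSet → t e ∈ e₀.source := fun e he => by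
      rw [e₀.mem_source, ← htt e (hQU e he)]
      exact he.2
    have htgt : ∀ z ∈ (Q' ⁻¹' U ∩ t' ⁻¹' e₀.baseSet) ×ˢ
        (Set.univ : Set (EuclideanSpace ℝ (Fin A.rank))), (t' z.1, z.2) ∈ e₀.target :=
      fun z hz => by
        rw [e₀.mem_target]
        exact hz.1.2
    have hfun : ContMDiffOn (SmoothMfd.I E) ((SmoothMfd.I E').prod (𝓡 A.rank)) ∞
        (fun e => (proj e, (e₀ (t e)).2)) (proj ⁻¹' (Q' ⁻¹' U ∩ t' ⁻¹' e₀.baseSet)) := by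
      refine hprojs.contMDiffOn.prodMk ((contMDiff_snd (I := SmoothMfd.I F')
        (J := 𝓡 A.rank) (n := ∞)).comp_contMDiffOn (hs.comp (hts.mono hQU) hsrc))
    have hinv : ContMDiffOn ((SmoothMfd.I E').prod (𝓡 A.rank)) (SmoothMfd.I E) ∞
        (fun z : E' × EuclideanSpace ℝ (Fin A.rank) =>
          fr (σ (Q' z.1)) (e₀.toOpenPartialHomeomorph.symm (t' z.1, z.2)))
        ((Q' ⁻¹' U ∩ t' ⁻¹' e₀.baseSet) ×ˢ Set.univ) := by
      refine H.smooth_frame.comp_contMDiffOn (ContMDiffOn.prodMk ?_ ?_)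
      · exact hσ.comp (H'.smooth_base.comp contMDiff_fst).contMDiffOn fun z hz => hz.1.1
      · refine hs'.comp ((hts'.comp contMDiff_fst.contMDiffOn fun z hz => hz.1.1).prodMk
          contMDiff_snd.contMDiffOn) ?_
        intro z hz
        exact htgt z hz
    have hprojinv : ∀ z ∈ (Q' ⁻¹' U ∩ t' ⁻¹' e₀.baseSet) ×ˢ
        (Set.univ : Set (EuclideanSpace ℝ (Fin A.rank))),
        proj (fr (σ (Q' z.1)) (e₀.toOpenPartialHomeomorph.symm (t' z.1, z.2))) = z.1 := by
      intro z hz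
      rw [hproj, e₀.proj_symm_apply (htgt z hz), ht' _ hz.1.1]
    let τ : Bundle.Trivialization (EuclideanSpace ℝ (Fin A.rank)) proj :=
      { toFun := fun e => (proj e, (e₀ (t e)).2)
        invFun := fun z => fr (σ (Q' z.1)) (e₀.toOpenPartialHomeomorph.symm (t' z.1, z.2))
        source := proj ⁻¹' (Q' ⁻¹' U ∩ t' ⁻¹' e₀.baseSet)
        target := (Q' ⁻¹' U ∩ t' ⁻¹' e₀.baseSet) ×ˢ Set.univ
        map_source' := fun e he => ⟨he, trivial⟩
        map_target' := fun z hz => by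
          rw [Set.mem_preimage, hprojinv z hz]
          exact hz.1
        left_inv' := fun e he => by
          have h1 : (t' (proj e), (e₀ (t e)).2) = e₀ (t e) := by
            rw [htt e (hQU e he)]
            exact Prod.ext (e₀.proj_toFun _ (hsrc e he)).symm rfl
          change fr (σ (Q' (proj e))) (e₀.toOpenPartialHomeomorph.symm
            (t' (proj e), (e₀ (t e)).2)) = e
          rw [h1, hQproj]
          have h2 := e₀.toOpenPartialHomeomorph.left_inv (hsrc e he)
          exact (congrArg _ h2).trans (ht e (hQU e he))
        right_inv' := fun z hz => by
          refine Prod.ext (hprojinv z hz) ?_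
          change (e₀ (t (fr (σ (Q' z.1))
            (e₀.toOpenPartialHomeomorph.symm (t' z.1, z.2))))).2 = z.2
          rw [htf _ hz.1.1]
          exact congrArg Prod.snd
            (e₀.toOpenPartialHomeomorph.right_inv (htgt z hz))
        open_source := hB.preimage hprojs.continuous
        open_target := hB.prod isOpen_univ
        continuousOn_toFun := hfun.continuousOn
        continuousOn_invFun := hinv.continuousOn
        baseSet := Q' ⁻¹' U ∩ t' ⁻¹' e₀.baseSet
        open_baseSet := hB
        source_eq := rfl
        target_eq := rfl
        proj_toFun := fun e he => rfl }
    refine ⟨τ, ⟨hb, he₀⟩, hfun, hinv, ?_, ?_, ?_⟩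
    · intro c hc
      change (e₀ (t (zero c))).2 = 0
      have h1 : zero c = fr (σ (Q' c)) (A.zero (t' c)) := by
        rw [← hzero, ht' c hc.1]
      rw [h1, htf _ hc.1, h0 _ hc.2]
    · intro x y hx hxy
      change (e₀ (t (add x y))).2 = (e₀ (t x)).2 + (e₀ (t y)).2
      have hy : proj y ∈ Q' ⁻¹' U ∩ t' ⁻¹' e₀.baseSet := hxy ▸ hx
      have hQxy : Q y = Q x := by rw [← hQproj, ← hxy, hQproj]
      have h1 : A.proj (t x) = A.proj (t y) := by
        rw [← htt x (hQU x hx), ← htt y (hQU y hy), hxy]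
      have h2 : add x y = fr (σ (Q x)) (A.add (t x) (t y)) := by
        rw [← hadd _ _ _ h1, ht x (hQU x hx), ← hQxy, ht y (hQU y hy)]
      rw [h2, htf _ (hQU x hx)]
      exact ha _ _ (e₀.mem_source.1 (hsrc x hx)) h1
    · intro r x hx
      change (e₀ (t (smul r x))).2 = r • (e₀ (t x)).2
      have h2 : smul r x = fr (σ (Q x)) (A.smul r (t x)) := by
        rw [← hsmul, ht x (hQU x hx)]
      rw [h2, htf _ (hQU x hx)]
      exact hm _ _ (e₀.mem_source.1 (hsrc x hx))

theorem IsAssocVB.exists_frame_eq {A : SmoothVB F F'} {A' : SmoothVB E E'}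
    (hA : IsAssocVB A A' fr fr') (H : IsAssocBundle a π l Q fr) (H' : IsAssocBundle a π l' Q' fr')
    (h : IsPrincipalBundle a ⊤ π) {x : X} {v : F} {e : E} (he : A'.proj (fr x v) = A'.proj e) :
    ∃ w, e = fr x w ∧ A.proj v = A.proj w := by
  obtain ⟨y, w, rfl⟩ := H.surjective e
  have hxy : π y = π x := by
    rw [hA.proj, hA.proj] at he
    rw [← H'.base_frame y (A.proj w), ← he, H'.base_frame]
  obtain ⟨w', hw'⟩ := H.exists_frame_eq h (x := x) (e := fr y w) (by rw [H.base_frame, hxy])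
  rw [← hw', hA.proj, hA.proj] at he
  exact ⟨w', hw'.symm, H'.injective _ he⟩

/-- A pair of maps which is in all frames given by one morphism of vector bundles is a morphism
of vector bundles. -/
theorem IsAssocVB.isVBHom {F₂ E₂ F₂' E₂' : Type*}
    [TopologicalSpace F₂] [SmoothMfd F₂] [TopologicalSpace E₂] [SmoothMfd E₂]
    [TopologicalSpace F₂'] [SmoothMfd F₂'] [TopologicalSpace E₂'] [SmoothMfd E₂']
    {l₂ : G → F₂ → F₂} {Q₂ : E₂ → M} {fr₂ : X → F₂ → E₂}
    {l₂' : G → F₂' → F₂'} {Q₂' : E₂' → M} {fr₂' : X → F₂' → E₂'}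
    {A : SmoothVB F F'} {A' : SmoothVB E E'} {B : SmoothVB F₂ F₂'} {B' : SmoothVB E₂ E₂'}
    (hA : IsAssocVB A A' fr fr') (hB : IsAssocVB B B' fr₂ fr₂')
    (H : IsAssocBundle a π l Q fr) (H' : IsAssocBundle a π l' Q' fr')
    (H₂ : IsAssocBundle a π l₂ Q₂ fr₂) (H₂' : IsAssocBundle a π l₂' Q₂' fr₂')
    (h : IsPrincipalBundle a ⊤ π) {f₀ : F → F₂} {g₀ : F' → F₂'} (hfg : IsVBHom A B f₀ g₀)
    {f : E → E₂} {g : E' → E₂'} (hf : ∀ x v, f (fr x v) = fr₂ x (f₀ v))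
    (hg : ∀ x v, g (fr' x v) = fr₂' x (g₀ v)) : IsVBHom A' B' f g where
  smooth := H.smoothMap H₂ h hfg.smooth hf
  smooth_base := H'.smoothMap H₂' h hfg.smooth_base hg
  proj e := by
    obtain ⟨x, v, rfl⟩ := H.surjective e
    rw [hf, hB.proj, hA.proj, hg, hfg.proj]
  add e₁ e₂ he := by
    obtain ⟨x, v, rfl⟩ := H.surjective e₁
    obtain ⟨w, rfl, hvw⟩ := hA.exists_frame_eq H H' h he
    rw [hA.add _ _ _ hvw, hf, hf, hf, hfg.add _ _ hvw, hB.add]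
    rw [hfg.proj, hfg.proj, hvw]
  smul r e := by
    obtain ⟨x, v, rfl⟩ := H.surjective e
    rw [hA.smul, hf, hf, hfg.smul, hB.smul]

section DoubleVectorBundles

variable {F₁ F₂ F₀ E₁ E₂ E₀ : Type*}
  [TopologicalSpace F₁] [SmoothMfd F₁] [TopologicalSpace E₁] [SmoothMfd E₁]
  [TopologicalSpace F₂] [SmoothMfd F₂] [TopologicalSpace E₂] [SmoothMfd E₂]
  [TopologicalSpace F₀] [SmoothMfd F₀] [TopologicalSpace E₀] [SmoothMfd E₀]
  {l₁ : G → F₁ → F₁} {Q₁ : E₁ → M} {fr₁ : X → F₁ → E₁}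
  {l₂ : G → F₂ → F₂} {Q₂ : E₂ → M} {fr₂ : X → F₂ → E₂}
  {l₀ : G → F₀ → F₀} {Q₀ : E₀ → M} {fr₀ : X → F₀ → E₀}

/-- The interchange law for two vector bundle structures on the fibre passes to the associated
bundle. -/
theorem IsAssocVB.interchange {A : SmoothVB F F₁} {A' : SmoothVB E E₁} {B : SmoothVB F F₂}
    {B' : SmoothVB E E₂} (hA : IsAssocVB A A' fr fr₁) (hB : IsAssocVB B B' fr fr₂)
    (H : IsAssocBundle a π l Q fr) (H₁ : IsAssocBundle a π l₁ Q₁ fr₁)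
    (H₂ : IsAssocBundle a π l₂ Q₂ fr₂) (h : IsPrincipalBundle a ⊤ π)
    {s₁ : F₁ → F₁ → F₁} {s₂ : F₂ → F₂ → F₂}
    (hs₁ : ∀ x y, B.proj x = B.proj y → A.proj (B.add x y) = s₁ (A.proj x) (A.proj y))
    (hs₂ : ∀ x y, A.proj x = A.proj y → B.proj (A.add x y) = s₂ (B.proj x) (B.proj y))
    (hAB : ∀ x y x' y', A.proj x = A.proj y → A.proj x' = A.proj y' →
      B.proj x = B.proj x' → B.proj y = B.proj y' →
      A.add (B.add x x') (B.add y y') = B.add (A.add x y) (A.add x' y'))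
    (x y x' y' : E) (hxy : A'.proj x = A'.proj y) (hxy' : A'.proj x' = A'.proj y')
    (hx : B'.proj x = B'.proj x') (hy : B'.proj y = B'.proj y') :
    A'.add (B'.add x x') (B'.add y y') = B'.add (A'.add x y) (A'.add x' y') := by
  obtain ⟨p, v, rfl⟩ := H.surjective x
  obtain ⟨w, rfl, hvw⟩ := hA.exists_frame_eq H H₁ h hxy
  obtain ⟨v', rfl, hv⟩ := hB.exists_frame_eq H H₂ h hx
  obtain ⟨w', rfl, hw⟩ := hB.exists_frame_eq H H₂ h hy
  rw [hA.proj, hA.proj] at hxy'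
  have hvw' : A.proj v' = A.proj w' := H₁.injective _ hxy'
  rw [hB.add _ _ _ hv, hB.add _ _ _ hw, hA.add _ _ _ hvw, hA.add _ _ _ hvw', hA.add, hB.add,
    hAB _ _ _ _ hvw hvw' hv hw]
  · rw [hs₂ _ _ hvw, hs₂ _ _ hvw', hv, hw]
  · rw [hs₁ _ _ hv, hs₁ _ _ hw, hvw, hvw']

/-- A double vector bundle with an action of the structure group by automorphisms induces a double
vector bundle of associated bundles. -/
theorem IsAssocBundle.exists_doubleVB (H : IsAssocBundle a π l Q fr)
    (H₁ : IsAssocBundle a π l₁ Q₁ fr₁) (H₂ : IsAssocBundle a π l₂ Q₂ fr₂)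
    (H₀ : IsAssocBundle a π l₀ Q₀ fr₀) (h : IsPrincipalBundle a ⊤ π) (𝕍 : DoubleVB F F₁ F₂ F₀)
    (hl : ∀ g, IsDoubleVBHom 𝕍 𝕍 (l g) (l₁ g) (l₂ g) (l₀ g)) :
    ∃ D : DoubleVB E E₁ E₂ E₀, IsAssocVB 𝕍.I D.I fr fr₁ ∧ IsAssocVB 𝕍.II D.II fr fr₂ ∧
      IsAssocVB 𝕍.S₁ D.S₁ fr₁ fr₀ ∧ IsAssocVB 𝕍.S₂ D.S₂ fr₂ fr₀ := by
  obtain ⟨I, hI⟩ := H.exists_smoothVB H₁ h 𝕍.I fun g => (hl g).homI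
  obtain ⟨II, hII⟩ := H.exists_smoothVB H₂ h 𝕍.II fun g => (hl g).homII
  obtain ⟨S₁, hS₁⟩ := H₁.exists_smoothVB H₀ h 𝕍.S₁ fun g => (hl g).hom₁
  obtain ⟨S₂, hS₂⟩ := H₂.exists_smoothVB H₀ h 𝕍.S₂ fun g => (hl g).hom₂
  refine ⟨{
    I := I
    II := II
    S₁ := S₁
    S₂ := S₂
    projI := hII.isVBHom hS₁ H H₂ H₁ H₀ h 𝕍.projI hI.proj hS₂.proj
    zeroI := hS₁.isVBHom hII H₁ H₀ H H₂ h 𝕍.zeroI hI.zero hS₂.zero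
    smulI := fun r => hII.isVBHom hII H H₂ H H₂ h (𝕍.smulI r) (hI.smul r) (hS₂.smul r)
    addI_proj := fun x y hxy => ?_
    addI_add := hI.interchange hII H H₁ H₂ h 𝕍.addII_proj 𝕍.addI_proj 𝕍.addI_add
    addI_smul := fun r x y hxy => ?_
    projII := hI.isVBHom hS₂ H H₁ H₂ H₀ h 𝕍.projII hII.proj hS₁.proj
    zeroII := hS₂.isVBHom hI H₂ H₀ H H₁ h 𝕍.zeroII hII.zero hS₁.zero
    smulII := fun r => hI.isVBHom hI H H₁ H H₁ h (𝕍.smulII r) (hII.smul r) (hS₁.smul r)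
    addII_proj := fun x y hxy => ?_
    addII_add := hII.interchange hI H H₂ H₁ h 𝕍.addI_proj 𝕍.addII_proj 𝕍.addII_add
    addII_smul := fun r x y hxy => ?_ }, hI, hII, hS₁, hS₂⟩
  · obtain ⟨p, v, rfl⟩ := H.surjective x
    obtain ⟨w, rfl, hvw⟩ := hI.exists_frame_eq H H₁ h hxy
    rw [hI.add _ _ _ hvw, hII.proj, hII.proj, hII.proj, 𝕍.addI_proj _ _ hvw, hS₂.add]
    rw [𝕍.projII.proj, 𝕍.projII.proj, hvw]
  · obtain ⟨p, v, rfl⟩ := H.surjective x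
    obtain ⟨w, rfl, hvw⟩ := hI.exists_frame_eq H H₁ h hxy
    rw [hI.add _ _ _ hvw, hII.smul, hII.smul, hII.smul, hI.add, 𝕍.addI_smul _ _ _ hvw]
    rw [(𝕍.smulII r).proj, (𝕍.smulII r).proj, hvw]
  · obtain ⟨p, v, rfl⟩ := H.surjective x
    obtain ⟨w, rfl, hvw⟩ := hII.exists_frame_eq H H₂ h hxy
    rw [hII.add _ _ _ hvw, hI.proj, hI.proj, hI.proj, 𝕍.addII_proj _ _ hvw, hS₁.add]
    rw [𝕍.projI.proj, 𝕍.projI.proj, hvw]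
  · obtain ⟨p, v, rfl⟩ := H.surjective x
    obtain ⟨w, rfl, hvw⟩ := hII.exists_frame_eq H H₂ h hxy
    rw [hII.add _ _ _ hvw, hI.smul, hI.smul, hI.smul, hII.add, 𝕍.addII_smul _ _ _ hvw]
    rw [(𝕍.smulI r).proj, (𝕍.smulI r).proj, hvw]

end DoubleVectorBundles

end Transfer

/-! ### Maps of constant rank -/

section ConstantRank

variable {E F : Type*} [NormedAddCommGroup E] [NormedSpace ℝ E]
  [NormedAddCommGroup F] [NormedSpace ℝ F] [FiniteDimensional ℝ F]

/-- A map whose rank is maximal at `x₀` among the nearby points and which is open at `x₀` is a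
submersion at `x₀`. By the constant rank theorem, the image of a neighbourhood is also the
image of an open subset of the range of the derivative, and if the latter is a proper
subspace, then the image has empty interior because its Hausdorff dimension is too small. -/
theorem ContDiffAt.range_fderiv_eq_top_of_nhds_le [FiniteDimensional ℝ E] {f : E → F}
    {x₀ : E} (hf : ContDiffAt ℝ 1 f x₀)
    (hrank : ∀ᶠ x in 𝓝 x₀, Module.finrank ℝ (fderiv ℝ f x).range ≤
      Module.finrank ℝ (fderiv ℝ f x₀).range)
    (hopen : 𝓝 (f x₀) ≤ Filter.map f (𝓝 x₀)) : (fderiv ℝ f x₀).range = ⊤ := by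
  by_contra htop
  set D := fderiv ℝ f x₀ with hD
  set R := D.range with hR
  set N := D.ker with hN
  have hlt : Module.finrank ℝ R < Module.finrank ℝ F := Submodule.finrank_lt htop
  obtain ⟨p₀, hp₀⟩ := R.subtype.exists_leftInverse_of_injective R.ker_subtype
  obtain ⟨n₀, hn₀⟩ := N.subtype.exists_leftInverse_of_injective N.ker_subtype
  let p : F →L[ℝ] R := LinearMap.toContinuousLinearMap p₀
  let n : E →L[ℝ] N := LinearMap.toContinuousLinearMap n₀
  have hp : ∀ y : R, p (y : F) = y := fun y => LinearMap.congr_fun hp₀ y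
  have hn : ∀ y : N, n (y : E) = y := fun y => LinearMap.congr_fun hn₀ y
  let Ψ : E → R × N := fun x => (p (f x), n x)
  let A : E →L[ℝ] R × N := (p.comp D).prod n
  have hfs : HasStrictFDerivAt f D x₀ := hf.hasStrictFDerivAt (by simp)
  have hΨ : HasStrictFDerivAt Ψ A x₀ :=
    (p.hasStrictFDerivAt.comp x₀ hfs).prodMk n.hasStrictFDerivAt
  have hAinj : Function.Injective (A : E →ₗ[ℝ] R × N) := by
    rw [← LinearMap.ker_eq_bot, LinearMap.ker_eq_bot']
    intro v hv
    have h1 : p (D v) = 0 := congrArg Prod.fst hv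
    have h2 : n v = 0 := congrArg Prod.snd hv
    have h3 : D v = 0 := by
      have := hp ⟨D v, v, rfl⟩
      rw [h1] at this
      exact (congrArg Subtype.val this).symm
    have h4 := hn ⟨v, h3⟩
    rw [h2] at h4
    exact (congrArg Subtype.val h4).symm
  have hdim : Module.finrank ℝ E = Module.finrank ℝ (R × N) := by
    rw [Module.finrank_prod]
    exact (LinearMap.finrank_range_add_finrank_ker (D : E →ₗ[ℝ] F)).symm
  let A' : E ≃L[ℝ] R × N :=
    (LinearEquiv.ofInjectiveOfFinrankEq (A : E →ₗ[ℝ] R × N) hAinj hdim).toContinuousLinearEquiv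
  have hΨ' : HasStrictFDerivAt Ψ (A' : E →L[ℝ] R × N) x₀ := by
    convert hΨ using 1
    exact ContinuousLinearMap.ext fun v => rfl
  let h := hΨ'.toOpenPartialHomeomorph Ψ
  have hsrc : x₀ ∈ h.source := hΨ'.mem_toOpenPartialHomeomorph_source
  have hcoe : ∀ x, h x = Ψ x := fun x => rfl
  have hΨc : ContDiffAt ℝ 1 Ψ x₀ :=
    (p.contDiff.contDiffAt.comp x₀ hf).prodMk n.contDiff.contDiffAt
  have hsymm0 : h.symm (Ψ x₀) = x₀ := h.left_inv hsrc
  have htgt : Ψ x₀ ∈ h.target := h.map_source hsrc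
  have hsc : ContDiffAt ℝ 1 h.symm (Ψ x₀) := by
    refine h.contDiffAt_symm (f₀' := A') htgt ?_ ?_
    · rw [hsymm0]
      exact hΨ'.hasFDerivAt
    · rw [hsymm0]
      exact hΨc
  have hev : ∀ᶠ w in 𝓝 (Ψ x₀), w ∈ h.target ∧ ContDiffAt ℝ 1 h.symm w ∧
      ContDiffAt ℝ 1 f (h.symm w) ∧
      Module.finrank ℝ (fderiv ℝ f (h.symm w)).range ≤ Module.finrank ℝ R := by
    have ht : Filter.Tendsto h.symm (𝓝 (Ψ x₀)) (𝓝 x₀) := by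
      have := hsc.continuousAt.tendsto
      rwa [hsymm0] at this
    exact (h.open_target.eventually_mem htgt).and ((hsc.eventually (by simp)).and
      ((ht.eventually (hf.eventually (by simp))).and (ht.eventually hrank)))
  obtain ⟨ε, hε, hball⟩ := Metric.eventually_nhds_iff_ball.1 hev
  let g : R × N → F := fun w => f (h.symm w)
  have hgc : ∀ w ∈ Metric.ball (Ψ x₀) ε, ContDiffAt ℝ 1 g w := fun w hw =>
    (hball w hw).2.2.1.comp w (hball w hw).2.1
  have hpg : ∀ w ∈ h.target, p (g w) = w.1 := fun w hw => congrArg Prod.fst (h.right_inv hw)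
  have hzero : ∀ w ∈ Metric.ball (Ψ x₀) ε, ∀ ζ : N, fderiv ℝ g w (0, ζ) = 0 := by
    intro w hw ζ
    obtain ⟨hwt, hw1, hw2, hw3⟩ := hball w hw
    have hgd : HasFDerivAt g (fderiv ℝ g w) w := ((hgc w hw).differentiableAt (by simp)).hasFDerivAt
    have hchain : fderiv ℝ g w = (fderiv ℝ f (h.symm w)).comp (fderiv ℝ h.symm w) :=
      fderiv_comp w (hw2.differentiableAt (by simp)) (hw1.differentiableAt (by simp))
    have hrk : Module.finrank ℝ (fderiv ℝ g w).range ≤ Module.finrank ℝ R := by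
      refine le_trans (Submodule.finrank_mono ?_) hw3
      rintro _ ⟨v, rfl⟩
      rw [hchain]
      exact ⟨_, rfl⟩
    have hpd : ∀ v, p (fderiv ℝ g w v) = v.1 := by
      have h1 : HasFDerivAt (fun w => p (g w)) (p.comp (fderiv ℝ g w)) w :=
        p.hasFDerivAt.comp w hgd
      have h2 : HasFDerivAt (fun w => p (g w)) (ContinuousLinearMap.fst ℝ R N) w :=
        hasFDerivAt_fst.congr_of_eventuallyEq (by
          filter_upwards [h.open_target.mem_nhds hwt] with y hy
          exact hpg y hy)
      exact fun v => DFunLike.congr_fun (h1.unique h2) v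
    let q : (fderiv ℝ g w).range →ₗ[ℝ] R := (p : F →ₗ[ℝ] R).comp (Submodule.subtype _)
    have hqs : Function.Surjective q := fun y =>
      ⟨⟨fderiv ℝ g w (y, 0), (y, 0), rfl⟩, hpd (y, 0)⟩
    have hqi : Function.Injective q :=
      (LinearMap.injective_iff_surjective_of_finrank_eq_finrank
        (le_antisymm hrk (LinearMap.finrank_le_finrank_of_surjective hqs))).2 hqs
    have h1 : (⟨fderiv ℝ g w (0, ζ), (0, ζ), rfl⟩ : (fderiv ℝ g w).range) = 0 :=
      hqi ((hpd (0, ζ)).trans (map_zero q).symm)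
    exact congrArg Subtype.val h1
  have hprod : ∀ w : R × N, w ∈ Metric.ball (Ψ x₀) ε ↔
      w.1 ∈ Metric.ball (Ψ x₀).1 ε ∧ w.2 ∈ Metric.ball (Ψ x₀).2 ε := fun w => by
    rw [← Set.mem_prod, ball_prod_same]
  have hconst : ∀ w ∈ Metric.ball (Ψ x₀) ε, g w = g (w.1, (Ψ x₀).2) := by
    intro w hw
    have hd : ∀ z ∈ Metric.ball (Ψ x₀).2 ε, HasFDerivAt (fun z => g (w.1, z))
        ((fderiv ℝ g (w.1, z)).comp (ContinuousLinearMap.inr ℝ R N)) z := by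
      intro z hz
      have hz' : (w.1, z) ∈ Metric.ball (Ψ x₀) ε := (hprod _).2 ⟨((hprod w).1 hw).1, hz⟩
      exact ((hgc _ hz').differentiableAt (by simp)).hasFDerivAt.comp z
        (hasFDerivAt_prodMk_right w.1 z)
    refine Metric.isOpen_ball.is_const_of_fderiv_eq_zero (𝕜 := ℝ) (f := fun z => g (w.1, z))
      (convex_ball (Ψ x₀).2 ε).isPreconnected
      (fun z hz => (hd z hz).differentiableAt.differentiableWithinAt) (fun z hz => ?_)
      ((hprod w).1 hw).2 (Metric.mem_ball_self hε)
    rw [(hd z hz).fderiv]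
    ext ζ
    exact hzero (w.1, z) ((hprod _).2 ⟨((hprod w).1 hw).1, hz⟩) ζ
  have hslice : ContDiffOn ℝ 1 (fun y : R => g (y, (Ψ x₀).2)) (Metric.ball (Ψ x₀).1 ε) := by
    intro y hy
    have hy' : (y, (Ψ x₀).2) ∈ Metric.ball (Ψ x₀) ε :=
      (hprod _).2 ⟨hy, Metric.mem_ball_self hε⟩
    exact ((hgc _ hy').comp y (contDiffAt_id.prodMk contDiffAt_const)).contDiffWithinAt
  have hdense := hslice.dense_compl_image_of_dimH_lt_finrank (convex_ball _ _) subset_rfl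
    (lt_of_le_of_lt (dimH_mono (Set.subset_univ _)) (by
      rw [Real.dimH_univ_eq_finrank R]
      exact_mod_cast hlt))
  have hnhds : h.source ∩ Ψ ⁻¹' Metric.ball (Ψ x₀) ε ∈ 𝓝 x₀ :=
    Filter.inter_mem (h.open_source.mem_nhds hsrc)
      (hΨc.continuousAt.preimage_mem_nhds (Metric.ball_mem_nhds _ hε))
  have himage := hopen (Filter.image_mem_map (m := f) hnhds)
  obtain ⟨y, hy, hy'⟩ := mem_closure_iff_nhds.1 (hdense (f x₀)) _ himage
  obtain ⟨x, ⟨hxs, hxb⟩, rfl⟩ := hy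
  refine hy' ⟨(Ψ x).1, ((hprod _).1 hxb).1, ?_⟩
  have h1 := hconst (Ψ x) hxb
  have h2 : g (Ψ x) = f x := congrArg f (h.left_inv hxs)
  rw [h2] at h1
  exact h1.symm

/-- A submersion has smooth local sections. -/
theorem ContDiffOn.exists_section {f : E → F} {Ω : Set E} {x₀ : E} (hΩ : IsOpen Ω) (hx₀ : x₀ ∈ Ω)
    (hf : ContDiffOn ℝ ∞ f Ω) (hsurj : (fderiv ℝ f x₀).range = ⊤) :
    ∃ (W : Set F) (s : F → E), IsOpen W ∧ f x₀ ∈ W ∧ ContDiffOn ℝ ∞ s W ∧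
      ∀ y ∈ W, s y ∈ Ω ∧ f (s y) = y := by
  have hfc : ∀ x ∈ Ω, ContDiffAt ℝ ∞ f x := fun x hx => hf.contDiffAt (hΩ.mem_nhds hx)
  obtain ⟨r₀, hr₀⟩ := (fderiv ℝ f x₀ : E →ₗ[ℝ] F).exists_rightInverse_of_surjective hsurj
  let r : F →L[ℝ] E := LinearMap.toContinuousLinearMap r₀
  have hr : ∀ y, fderiv ℝ f x₀ (r y) = y := fun y => LinearMap.congr_fun hr₀ y
  let c : F → E := fun y => x₀ + r (y - f x₀)
  have hc : ContDiff ℝ ∞ c :=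
    contDiff_const.add (r.contDiff.comp (contDiff_id.sub contDiff_const))
  have hc0 : c (f x₀) = x₀ := by simp [c]
  let k : F → F := fun y => f (c y)
  have hk0 : k (f x₀) = f x₀ := congrArg f hc0
  have hΩ' : IsOpen (c ⁻¹' Ω) := hΩ.preimage hc.continuous
  have hkc : ∀ y ∈ c ⁻¹' Ω, ContDiffAt ℝ ∞ k y := fun y hy =>
    (hfc (c y) hy).comp y hc.contDiffAt
  have hmem : f x₀ ∈ c ⁻¹' Ω := by rw [Set.mem_preimage, hc0]; exact hx₀
  have hkd : HasStrictFDerivAt k ((ContinuousLinearEquiv.refl ℝ F : F ≃L[ℝ] F) : F →L[ℝ] F)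
      (f x₀) := by
    have h1 : HasStrictFDerivAt c r (f x₀) :=
      (r.hasStrictFDerivAt.comp (f x₀) ((hasStrictFDerivAt_id _).sub_const _)).const_add x₀
    have h2 : HasStrictFDerivAt f (fderiv ℝ f x₀) (c (f x₀)) := by
      rw [hc0]
      exact (hfc x₀ hx₀).hasStrictFDerivAt (by simp)
    convert h2.comp (f x₀) h1 using 1
    ext y
    exact (hr y).symm
  let h := hkd.toOpenPartialHomeomorph k
  have hsrc : f x₀ ∈ h.source := hkd.mem_toOpenPartialHomeomorph_source
  have htgt : f x₀ ∈ h.target := by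
    have := h.map_source hsrc
    rwa [show h (f x₀) = f x₀ from hk0] at this
  -- the derivative of `k` stays invertible near `f x₀`
  let Z : Set F := c ⁻¹' Ω ∩ (fderiv ℝ k) ⁻¹' Set.range
    (fun e : F ≃L[ℝ] F => (e : F →L[ℝ] F))
  have hZ : IsOpen Z := by
    have hcont : ContinuousOn (fderiv ℝ k) (c ⁻¹' Ω) := by
      intro y hy
      exact ((hkc y hy).fderiv_right (m := 0) (by simp)).continuousAt.continuousWithinAt
    exact hcont.isOpen_inter_preimage hΩ' ContinuousLinearEquiv.isOpen
  have hZ0 : f x₀ ∈ Z := ⟨hmem, ContinuousLinearEquiv.refl ℝ F, hkd.hasFDerivAt.fderiv.symm⟩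
  have hs0 : h.symm (f x₀) = f x₀ := by
    have := h.left_inv hsrc
    rwa [show h (f x₀) = f x₀ from hk0] at this
  refine ⟨h.target ∩ h.symm ⁻¹' Z, fun y => c (h.symm y), h.isOpen_inter_preimage_symm hZ,
    ⟨htgt, by rw [Set.mem_preimage, hs0]; exact hZ0⟩, ?_, ?_⟩
  · rintro y ⟨hy, hyZ⟩
    obtain ⟨hyc, e, he⟩ := hyZ
    refine (hc.contDiffAt.comp y (h.contDiffAt_symm (f₀' := e) hy ?_ ?_)).contDiffWithinAt
    · have h1 : HasFDerivAt k (fderiv ℝ k (h.symm y)) (h.symm y) :=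
        ((hkc _ hyc).differentiableAt (by simp)).hasFDerivAt
      rwa [← he] at h1
    · exact hkc _ hyc
  · rintro y ⟨hy, hyZ⟩
    exact ⟨hyZ.1, h.right_inv hy⟩

end ConstantRank

/-! ### Homomorphisms of Lie groups and towers of principal bundles -/

theorem SmoothMfd.contMDiffAt_chartAt {X : Type*} [TopologicalSpace X] [SmoothMfd X] {x y : X}
    (h : y ∈ (chartAt (EuclideanSpace ℝ (Fin (SmoothMfd.dim X))) x).source) :
    ContMDiffAt (SmoothMfd.I X) (SmoothMfd.I X) ∞
      (chartAt (EuclideanSpace ℝ (Fin (SmoothMfd.dim X))) x) y :=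
  contMDiffOn_chart.contMDiffAt ((OpenPartialHomeomorph.open_source _).mem_nhds h)

theorem SmoothMfd.contMDiffAt_chartAt_symm {X : Type*} [TopologicalSpace X] [SmoothMfd X] {x : X}
    {y : EuclideanSpace ℝ (Fin (SmoothMfd.dim X))}
    (h : y ∈ (chartAt (EuclideanSpace ℝ (Fin (SmoothMfd.dim X))) x).target) :
    ContMDiffAt (SmoothMfd.I X) (SmoothMfd.I X) ∞
      (chartAt (EuclideanSpace ℝ (Fin (SmoothMfd.dim X))) x).symm y :=
  contMDiffOn_chart_symm.contMDiffAt ((OpenPartialHomeomorph.open_target _).mem_nhds h)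

section LieGroups

variable {G H : Type*} [Group G] [TopologicalSpace G] [SmoothMfd G]
  [LieGroup (SmoothMfd.I G) ∞ G] [Group H] [TopologicalSpace H] [SmoothMfd H]
  [LieGroup (SmoothMfd.I H) ∞ H]

/-- A surjective homomorphism of Lie groups has smooth local sections. It is open by the open mapping
theorem, for which `G` has to be second countable, and of constant rank by equivariance under
translations; so it is a submersion. -/
theorem MonoidHom.exists_contMDiffOn_section (ψ : G →* H) (hψ : SmoothMap ψ)
    (hsurj : Function.Surjective ψ) :
    ∃ (U : Set H) (s : H → G), IsOpen U ∧ 1 ∈ U ∧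
      ContMDiffOn (SmoothMfd.I H) (SmoothMfd.I G) ∞ s U ∧ ∀ u ∈ U, ψ (s u) = u := by
  have : IsTopologicalGroup G := topologicalGroup_of_lieGroup (SmoothMfd.I G) ∞
  have : IsTopologicalGroup H := topologicalGroup_of_lieGroup (SmoothMfd.I H) ∞
  have : LocallyCompactSpace G :=
    ChartedSpace.locallyCompactSpace (EuclideanSpace ℝ (Fin (SmoothMfd.dim G))) G
  have : LocallyCompactSpace H :=
    ChartedSpace.locallyCompactSpace (EuclideanSpace ℝ (Fin (SmoothMfd.dim H))) H
  have hopen : IsOpenMap ψ := ψ.isOpenMap_of_sigmaCompact hsurj hψ.continuous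
  set e := chartAt (EuclideanSpace ℝ (Fin (SmoothMfd.dim G))) (1 : G) with he
  set e' := chartAt (EuclideanSpace ℝ (Fin (SmoothMfd.dim H))) (1 : H) with he'
  have h1 : (1 : G) ∈ e.source := mem_chart_source _ _
  have h1' : (1 : H) ∈ e'.source := mem_chart_source _ _
  let Ω : Set (EuclideanSpace ℝ (Fin (SmoothMfd.dim G))) := e.target ∩ e.symm ⁻¹' (ψ ⁻¹' e'.source)
  have hΩ : IsOpen Ω := e.isOpen_inter_preimage_symm (e'.open_source.preimage hψ.continuous)
  let f : EuclideanSpace ℝ (Fin (SmoothMfd.dim G)) → EuclideanSpace ℝ (Fin (SmoothMfd.dim H)) :=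
    fun x => e' (ψ (e.symm x))
  have hx₀ : e 1 ∈ Ω := by
    refine ⟨e.map_source h1, ?_⟩
    rw [Set.mem_preimage, e.left_inv h1, Set.mem_preimage, map_one]
    exact h1'
  have hf₀ : f (e 1) = e' 1 := by
    change e' (ψ (e.symm (e 1))) = e' 1
    rw [e.left_inv h1, map_one]
  have hf : ContDiffOn ℝ ∞ f Ω := by
    rw [← contMDiffOn_iff_contDiffOn]
    intro x hx
    exact ((SmoothMfd.contMDiffAt_chartAt hx.2).comp x
      ((hψ _).comp x (SmoothMfd.contMDiffAt_chartAt_symm hx.1))).contMDiffWithinAt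
  have hfd : ∀ x ∈ Ω, DifferentiableAt ℝ f x := fun x hx =>
    (hf.contDiffAt (hΩ.mem_nhds hx)).differentiableAt (by simp)
  have hrank : ∀ᶠ x in 𝓝 (e 1), Module.finrank ℝ (fderiv ℝ f x).range ≤
      Module.finrank ℝ (fderiv ℝ f (e 1)).range := by
    filter_upwards [hΩ.mem_nhds hx₀] with x hx
    -- `f` near `x` is `f` near `e 1` composed with two translations
    set g := e.symm x with hg
    let α : EuclideanSpace ℝ (Fin (SmoothMfd.dim H)) → EuclideanSpace ℝ (Fin (SmoothMfd.dim H)) :=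
      fun y => e' (ψ g * e'.symm y)
    let β : EuclideanSpace ℝ (Fin (SmoothMfd.dim G)) → EuclideanSpace ℝ (Fin (SmoothMfd.dim G)) :=
      fun y => e (g⁻¹ * e.symm y)
    have hβx : β x = e 1 := by
      change e (g⁻¹ * g) = e 1
      rw [inv_mul_cancel]
    have hα : DifferentiableAt ℝ α (f (β x)) := by
      rw [hβx, hf₀]
      refine ContDiffAt.differentiableAt (n := ∞) ?_ (by simp)
      rw [← contMDiffAt_iff_contDiffAt]
      have h2 : ContMDiffAt (SmoothMfd.I H) (SmoothMfd.I H) ∞ e'.symm (e' 1) :=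
        SmoothMfd.contMDiffAt_chartAt_symm (e'.map_source h1')
      refine (SmoothMfd.contMDiffAt_chartAt ?_).comp (e' 1) (contMDiffAt_const.mul h2)
      rw [e'.left_inv h1', mul_one]
      exact hx.2
    have hβ : DifferentiableAt ℝ β x := by
      refine ContDiffAt.differentiableAt (n := ∞) ?_ (by simp)
      rw [← contMDiffAt_iff_contDiffAt]
      have h2 : ContMDiffAt (SmoothMfd.I G) (SmoothMfd.I G) ∞ e.symm x :=
        SmoothMfd.contMDiffAt_chartAt_symm hx.1
      refine (SmoothMfd.contMDiffAt_chartAt ?_).comp x (contMDiffAt_const.mul h2)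
      rw [← hg, inv_mul_cancel]
      exact h1
    have heq : f =ᶠ[𝓝 x] fun y => α (f (β y)) := by
      have hc : ContinuousAt (fun y => g⁻¹ * e.symm y) x :=
        continuousAt_const.mul (e.continuousAt_symm hx.1)
      have hn : e.source ∩ ψ ⁻¹' e'.source ∈ 𝓝 (g⁻¹ * e.symm x) := by
        refine (e.open_source.inter (e'.open_source.preimage hψ.continuous)).mem_nhds ?_
        rw [← hg, inv_mul_cancel]
        refine ⟨h1, ?_⟩
        rw [Set.mem_preimage, map_one]
        exact h1'
      filter_upwards [hc.preimage_mem_nhds hn] with y hy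
      change e' (ψ (e.symm y)) = e' (ψ g * e'.symm (e' (ψ (e.symm (e (g⁻¹ * e.symm y))))))
      rw [e.left_inv hy.1, e'.left_inv hy.2, ← map_mul, mul_inv_cancel_left]
    have hd : fderiv ℝ f x =
        ((fderiv ℝ α (f (β x))).comp (fderiv ℝ f (e 1))).comp (fderiv ℝ β x) := by
      have h2 : HasFDerivAt f (fderiv ℝ f (e 1)) (β x) := by
        rw [hβx]
        exact (hfd _ hx₀).hasFDerivAt
      rw [heq.fderiv_eq]
      exact ((hα.hasFDerivAt.comp (β x) h2).comp x hβ.hasFDerivAt).fderiv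
    refine le_trans (Submodule.finrank_mono (t := (fderiv ℝ f (e 1)).range.map
      (fderiv ℝ α (f (β x)) : EuclideanSpace ℝ (Fin (SmoothMfd.dim H)) →ₗ[ℝ]
        EuclideanSpace ℝ (Fin (SmoothMfd.dim H)))) ?_) (Submodule.finrank_map_le _ _)
    rintro _ ⟨v, rfl⟩
    rw [hd]
    exact ⟨_, ⟨_, rfl⟩, rfl⟩
  have hnhds : 𝓝 (f (e 1)) ≤ Filter.map f (𝓝 (e 1)) := by
    have h2 : Filter.map f (𝓝 (e 1)) = Filter.map e' (Filter.map ψ (𝓝 1)) := by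
      rw [← e.symm_map_nhds_eq h1, Filter.map_map, Filter.map_map]
      rfl
    rw [h2, hf₀, ← e'.map_nhds_eq h1']
    have h3 := hopen.nhds_le 1
    rw [map_one] at h3
    exact Filter.map_mono h3
  have hsub := ((hf.contDiffAt (hΩ.mem_nhds hx₀)).of_le (by simp)).range_fderiv_eq_top_of_nhds_le
    hrank hnhds
  obtain ⟨W, s, hW, hW₀, hs, hsW⟩ := hf.exists_section hΩ hx₀ hsub
  refine ⟨e'.source ∩ e' ⁻¹' W, fun y => e.symm (s (e' y)), e'.isOpen_inter_preimage hW,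
    ⟨h1', ?_⟩, ?_, ?_⟩
  · rw [Set.mem_preimage, ← hf₀]
    exact hW₀
  · rintro y ⟨hy, hyW⟩
    have h2 : ContMDiffAt (SmoothMfd.I H) (SmoothMfd.I G) ∞ s (e' y) :=
      (contMDiffOn_iff_contDiffOn.2 hs).contMDiffAt (hW.mem_nhds hyW)
    exact ((SmoothMfd.contMDiffAt_chartAt_symm (hsW _ hyW).1.1).comp y
      (h2.comp y (SmoothMfd.contMDiffAt_chartAt hy))).contMDiffWithinAt
  · rintro y ⟨hy, hyW⟩
    obtain ⟨hΩy, hfy⟩ := hsW _ hyW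
    exact e'.injOn hΩy.2 hy hfy

end LieGroups

/-- A tower of principal bundles `X → Y → M`, the first of which is equivariant along a surjective
homomorphism of Lie groups with kernel its structure group, is a principal bundle. -/
theorem IsPrincipalBundle.trans {X Y M G H : Type*} [TopologicalSpace X] [SmoothMfd X]
    [TopologicalSpace Y] [SmoothMfd Y] [TopologicalSpace M] [SmoothMfd M]
    [Group G] [TopologicalSpace G] [SmoothMfd G] [LieGroup (SmoothMfd.I G) ∞ G]
    [Group H] [TopologicalSpace H] [SmoothMfd H] [LieGroup (SmoothMfd.I H) ∞ H]
    {a : SmoothRightAction X G} {b : SmoothRightAction Y H} {p : X → Y} {q : Y → M} {ψ : G →* H}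
    (hp : IsPrincipalBundle a ψ.ker p) (hq : IsPrincipalBundle b ⊤ q) (hψ : SmoothMap ψ)
    (hsurj : Function.Surjective ψ) (hact : ∀ x g, p (a.act x g) = b.act (p x) (ψ g)) :
    IsPrincipalBundle a ⊤ (fun x => q (p x)) := by
  classical
  have hfree : ∀ x g, a.act x g = x → g = 1 := by
    intro x g hg
    refine hp.free x g ?_ hg
    rw [MonoidHom.mem_ker]
    refine hq.free (p x) _ trivial ?_
    rw [← hact, hg]
  have hinj : ∀ x g g', a.act x g = a.act x g' → g = g' := by
    intro x g g' hgg
    refine mul_inv_eq_one.1 (hfree x _ ?_)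
    rw [a.act_mul, hgg, a.act_act_inv]
  have htrans : ∀ x y, q (p x) = q (p y) → ∃ g, a.act x g = y := by
    intro x y hxy
    obtain ⟨h, -, hh⟩ := hq.exists_act hxy
    obtain ⟨g, rfl⟩ := hsurj h
    rw [← hact] at hh
    obtain ⟨k, -, hk⟩ := hp.exists_act hh
    exact ⟨g * k, by rw [a.act_mul, hk]⟩
  refine ⟨hq.smooth.comp hp.smooth, fun x g _ => hfree x g, fun x g _ => ?_, fun m => ?_⟩
  · rw [hact, hq.invariant _ _ trivial]
  obtain ⟨U₁, s₁, τ₁, hU₁, hm, hs₁, hτ₁, hqs₁, hsτ₁⟩ := hq.locally_trivial m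
  obtain ⟨W, s, κ, hW, hmW, hs, hκ, hps, hsκ⟩ := hp.locally_trivial (s₁ m)
  have hU : IsOpen (U₁ ∩ s₁ ⁻¹' W) := hs₁.continuousOn.isOpen_inter_preimage hU₁ hW
  have hσ : ∀ u ∈ U₁ ∩ s₁ ⁻¹' W, q (p (s (s₁ u))) = u := fun u hu => by
    rw [hps _ hu.2, hqs₁ _ hu.1]
  have hex : ∀ x, ∃ g, q (p x) ∈ U₁ ∩ s₁ ⁻¹' W → a.act (s (s₁ (q (p x)))) g = x := by
    intro x
    by_cases hx : q (p x) ∈ U₁ ∩ s₁ ⁻¹' W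
    · obtain ⟨g, hg⟩ := htrans _ _ (hσ _ hx)
      exact ⟨g, fun _ => hg⟩
    · exact ⟨1, fun hx' => absurd hx' hx⟩
  choose τ hτ using hex
  refine ⟨U₁ ∩ s₁ ⁻¹' W, fun u => s (s₁ u), τ, hU, ⟨hm, hmW⟩,
    hs.comp (hs₁.mono fun u hu => hu.1) fun u hu => hu.2, fun x hx => ?_, hσ,
    fun x hx => ⟨trivial, hτ x hx⟩⟩
  obtain ⟨Z, γ, hZ, hZ1, hγ, hψγ⟩ := ψ.exists_contMDiffOn_section hψ hsurj
  obtain ⟨g₀, hg₀⟩ := hsurj (τ₁ (p x))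
  -- near `x`, a smooth lift of the `H`-coordinate to `G` corrects `y` to a point over the section
  -- of `Y`, where the coordinate of the bundle `X → Y` applies
  have hτp : ContMDiffOn (SmoothMfd.I X) (SmoothMfd.I H) ∞ (fun y => (ψ g₀)⁻¹ * τ₁ (p y))
      ((fun y => q (p y)) ⁻¹' U₁) :=
    contMDiffOn_const.mul (hτ₁.comp hp.smooth.contMDiffOn fun y hy => hy)
  have hqp : Continuous fun y => q (p y) := (hq.smooth.comp hp.smooth).continuous
  let O : Set X := (fun y => q (p y)) ⁻¹' (U₁ ∩ s₁ ⁻¹' W) ∩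
    ((fun y => q (p y)) ⁻¹' U₁ ∩ (fun y => (ψ g₀)⁻¹ * τ₁ (p y)) ⁻¹' Z)
  have hO : IsOpen O := (hU.preimage hqp).inter
    (hτp.continuousOn.isOpen_inter_preimage (hU₁.preimage hqp) hZ)
  have hxO : x ∈ O := by
    refine ⟨hx, hx.1, ?_⟩
    rw [Set.mem_preimage, hg₀, inv_mul_cancel]
    exact hZ1
  let g : X → G := fun y => g₀ * γ ((ψ g₀)⁻¹ * τ₁ (p y))
  have hg : ContMDiffOn (SmoothMfd.I X) (SmoothMfd.I G) ∞ g O :=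
    contMDiffOn_const.mul (hγ.comp (hτp.mono fun y hy => hy.2.1) fun y hy => hy.2.2)
  have hψg : ∀ y ∈ O, ψ (g y) = τ₁ (p y) := fun y hy => by
    change ψ (g₀ * γ ((ψ g₀)⁻¹ * τ₁ (p y))) = _
    rw [map_mul, hψγ _ hy.2.2, mul_inv_cancel_left]
  have hpz : ∀ y ∈ O, p (a.act y (g y)⁻¹) = s₁ (q (p y)) := fun y hy => by
    rw [hact, map_inv, hψg y hy]
    exact b.act_inv_of_eq (hsτ₁ (p y) hy.1.1).2
  have hz : ContMDiffOn (SmoothMfd.I X) (SmoothMfd.I X) ∞ (fun y => a.act y (g y)⁻¹) O :=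
    a.smooth.comp_contMDiffOn (contMDiffOn_id.prodMk hg.inv)
  have hfin : ContMDiffOn (SmoothMfd.I X) (SmoothMfd.I G) ∞
      (fun y => κ (a.act y (g y)⁻¹) * g y) O := by
    refine (hκ.comp hz fun y hy => ?_).mul hg
    rw [Set.mem_preimage, Set.mem_preimage, hpz y hy]
    exact hy.1.2
  refine ((hfin.contMDiffAt (hO.mem_nhds hxO)).congr_of_eventuallyEq ?_).contMDiffWithinAt
  filter_upwards [hO.mem_nhds hxO] with y hy
  refine hinj (s (s₁ (q (p y)))) _ _ ?_
  have h1 := (hsκ (a.act y (g y)⁻¹) (by rw [hpz y hy]; exact hy.1.2)).2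
  rw [hpz y hy] at h1
  rw [hτ y hy.1, a.act_mul, h1, ← a.act_mul, inv_mul_cancel, a.act_one]

section DoublePrincipal

variable {G G₁ G₂ G₀ : Type*}
  [Group G] [TopologicalSpace G] [SmoothMfd G] [LieGroup (SmoothMfd.I G) ∞ G]
  [Group G₁] [TopologicalSpace G₁] [SmoothMfd G₁] [LieGroup (SmoothMfd.I G₁) ∞ G₁]
  [Group G₂] [TopologicalSpace G₂] [SmoothMfd G₂] [LieGroup (SmoothMfd.I G₂) ∞ G₂]
  [Group G₀] [TopologicalSpace G₀] [SmoothMfd G₀] [LieGroup (SmoothMfd.I G₀) ∞ G₀]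
  {P P₁ P₂ M : Type*}
  [TopologicalSpace P] [SmoothMfd P] [TopologicalSpace P₁] [SmoothMfd P₁]
  [TopologicalSpace P₂] [SmoothMfd P₂] [TopologicalSpace M] [SmoothMfd M]
  {𝔾 : DoubleLieGroup G G₁ G₂ G₀}

theorem DoubleLieGroup.surjective_φ₁ (𝔾 : DoubleLieGroup G G₁ G₂ G₀) :
    Function.Surjective 𝔾.φ₁ := fun g => by
  obtain ⟨k, hk⟩ := 𝔾.surjective_φ (g, 1)
  exact ⟨k, congrArg Prod.fst hk⟩

theorem DoubleLieGroup.smooth_φ₁ (𝔾 : DoubleLieGroup G G₁ G₂ G₀) : SmoothMap 𝔾.φ₁ :=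
  contMDiff_fst.comp 𝔾.smooth_φ

/-- The projection `π₁` is equivariant under all of `G`, because `G = K₂ K₁`. -/
theorem DoublePB.π₁_act (ℙ : DoublePB 𝔾 P P₁ P₂ M) (p : P) (g : G) :
    ℙ.π₁ (ℙ.actP.act p g) = ℙ.actP₁.act (ℙ.π₁ p) (𝔾.φ₁ g) := by
  obtain ⟨k, hk⟩ := 𝔾.surjective_φ (𝔾.φ₁ g, 1)
  have hk1 : 𝔾.φ₁ k = 𝔾.φ₁ g := (Prod.ext_iff.1 hk).1
  have hk2 : k ∈ 𝔾.K₂ := (Prod.ext_iff.1 hk).2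
  have hk3 : k⁻¹ * g ∈ 𝔾.K₁ := by
    change 𝔾.φ₁ (k⁻¹ * g) = 1
    rw [map_mul, map_inv, hk1, inv_mul_cancel]
  rw [← hk1, ← ℙ.equivariant₁ p k hk2, ← ℙ.principal_I.invariant (ℙ.actP.act p k) _ hk3,
    ← ℙ.actP.act_mul, mul_inv_cancel_left]

theorem DoublePB.π₂_act (ℙ : DoublePB 𝔾 P P₁ P₂ M) (p : P) (g : G) :
    ℙ.π₂ (ℙ.actP.act p g) = ℙ.actP₂.act (ℙ.π₂ p) (𝔾.φ₂ g) := by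
  obtain ⟨k, hk⟩ := 𝔾.surjective_φ (1, 𝔾.φ₂ g)
  have hk1 : 𝔾.φ₂ k = 𝔾.φ₂ g := (Prod.ext_iff.1 hk).2
  have hk2 : k ∈ 𝔾.K₁ := (Prod.ext_iff.1 hk).1
  have hk3 : k⁻¹ * g ∈ 𝔾.K₂ := by
    change 𝔾.φ₂ (k⁻¹ * g) = 1
    rw [map_mul, map_inv, hk1, inv_mul_cancel]
  rw [← hk1, ← ℙ.equivariant₂ p k hk2, ← ℙ.principal_II.invariant (ℙ.actP.act p k) _ hk3,
    ← ℙ.actP.act_mul, mul_inv_cancel_left]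

theorem DoublePB.isPrincipalBundle (ℙ : DoublePB 𝔾 P P₁ P₂ M) :
    IsPrincipalBundle ℙ.actP ⊤ fun p => ℙ.l₁ (ℙ.π₁ p) :=
  ℙ.principal_I.trans ℙ.principal₁ 𝔾.smooth_φ₁ 𝔾.surjective_φ₁ ℙ.π₁_act

end DoublePrincipal

/-! ### The core of a double vector space -/

section FibreChart

variable {X B : Type*} [TopologicalSpace X] [SmoothMfd X] [TopologicalSpace B] [SmoothMfd B]

/-- A linear parametrization `ι` of the fibre over `b` by `ℝ^rank`, whose inverse is the restriction of
a map `κ` that is smooth on a neighbourhood `W` of the fibre. -/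
structure IsFibreChart (A : SmoothVB X B) (b : B) (W : Set X)
    (κ : X → EuclideanSpace ℝ (Fin A.rank)) (ι : EuclideanSpace ℝ (Fin A.rank) → X) : Prop where
  isOpen : IsOpen W
  mem : ∀ x, A.proj x = b → x ∈ W
  smooth_coord : ContMDiffOn (SmoothMfd.I X) (𝓡 A.rank) ∞ κ W
  smooth_param : ContMDiff (𝓡 A.rank) (SmoothMfd.I X) ∞ ι
  proj_param : ∀ y, A.proj (ι y) = b
  coord_param : ∀ y, κ (ι y) = y
  param_coord : ∀ x, A.proj x = b → ι (κ x) = x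
  coord_zero : κ (A.zero b) = 0
  coord_add : ∀ x y, A.proj x = b → A.proj y = b → κ (A.add x y) = κ x + κ y
  coord_smul : ∀ (r : ℝ) x, A.proj x = b → κ (A.smul r x) = r • κ x

theorem SmoothVB.exists_isFibreChart (A : SmoothVB X B) (b : B) :
    ∃ W κ ι, IsFibreChart A b W κ ι := by
  obtain ⟨e, hb, hs, hs', h0, ha, hm⟩ := A.locally_trivial b
  have hsrc : ∀ x, A.proj x = b → x ∈ e.source := fun x hx => e.mem_source.2 (hx ▸ hb)
  have htgt : ∀ y, (b, y) ∈ e.target := fun y => by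
    rw [e.mem_target]
    exact hb
  refine ⟨e.source, fun x => (e x).2, fun y => e.toOpenPartialHomeomorph.symm (b, y),
    e.open_source, hsrc, contMDiff_snd.comp_contMDiffOn hs, ?_,
    fun y => e.proj_symm_apply (htgt y), ?_, ?_, h0 b hb,
    fun x y hx hy => ha x y (hx ▸ hb) (hx.trans hy.symm), fun r x hx => hm r x (hx ▸ hb)⟩
  · rw [← contMDiffOn_univ]
    exact hs'.comp (contMDiff_const.prodMk contMDiff_id).contMDiffOn fun y _ => htgt y
  · intro y
    exact congrArg Prod.snd (e.toOpenPartialHomeomorph.right_inv (htgt y))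
  · intro x hx
    have h1 : (b, (e x).2) = e.toOpenPartialHomeomorph x :=
      Prod.ext (hx.symm.trans (e.proj_toFun x (hsrc x hx)).symm) rfl
    rw [h1]
    exact e.toOpenPartialHomeomorph.left_inv (hsrc x hx)

variable {A : SmoothVB X B} {b : B} {W : Set X} {κ : X → EuclideanSpace ℝ (Fin A.rank)}
  {ι : EuclideanSpace ℝ (Fin A.rank) → X}

theorem IsFibreChart.ext (h : IsFibreChart A b W κ ι) {x y : X} (hx : A.proj x = b)
    (hy : A.proj y = b) (hxy : κ x = κ y) : x = y := by
  rw [← h.param_coord x hx, ← h.param_coord y hy, hxy]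

theorem IsFibreChart.param_add (h : IsFibreChart A b W κ ι) (y z) :
    ι (y + z) = A.add (ι y) (ι z) := by
  have hp : A.proj (ι y) = A.proj (ι z) := by rw [h.proj_param, h.proj_param]
  refine h.ext (h.proj_param _) (by rw [A.proj_add _ _ hp, h.proj_param]) ?_
  rw [h.coord_add _ _ (h.proj_param y) (h.proj_param z), h.coord_param, h.coord_param,
    h.coord_param]

theorem IsFibreChart.param_smul (h : IsFibreChart A b W κ ι) (r : ℝ) (y) :
    ι (r • y) = A.smul r (ι y) := by
  refine h.ext (h.proj_param _) (by rw [A.proj_smul, h.proj_param]) ?_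
  rw [h.coord_smul _ _ (h.proj_param y), h.coord_param, h.coord_param]

theorem SmoothVB.add_zero (A : SmoothVB X B) {x : X} {b : B} (hx : A.proj x = b) :
    A.add x (A.zero b) = x := by
  obtain ⟨W, κ, ι, h⟩ := A.exists_isFibreChart b
  have h0 := A.proj_zero b
  refine h.ext ((A.proj_add _ _ (hx.trans h0.symm)).trans hx) hx ?_
  rw [h.coord_add _ _ hx h0, h.coord_zero, _root_.add_zero]

theorem SmoothVB.zero_add (A : SmoothVB X B) {x : X} {b : B} (hx : A.proj x = b) :
    A.add (A.zero b) x = x := by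
  obtain ⟨W, κ, ι, h⟩ := A.exists_isFibreChart b
  have h0 := A.proj_zero b
  refine h.ext ((A.proj_add _ _ (h0.trans hx.symm)).trans h0) hx ?_
  rw [h.coord_add _ _ h0 hx, h.coord_zero, _root_.zero_add]

theorem SmoothVB.one_smul (A : SmoothVB X B) (x : X) : A.smul 1 x = x := by
  obtain ⟨W, κ, ι, h⟩ := A.exists_isFibreChart (A.proj x)
  refine h.ext (A.proj_smul _ _) rfl ?_
  rw [h.coord_smul _ _ rfl, _root_.one_smul]

theorem SmoothVB.add_smul (A : SmoothVB X B) (r s : ℝ) (x : X) :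
    A.smul (r + s) x = A.add (A.smul r x) (A.smul s x) := by
  obtain ⟨W, κ, ι, h⟩ := A.exists_isFibreChart (A.proj x)
  have hr := A.proj_smul r x
  have hs := A.proj_smul s x
  refine h.ext (A.proj_smul _ _) ((A.proj_add _ _ (hr.trans hs.symm)).trans hr) ?_
  rw [h.coord_smul _ _ rfl, h.coord_add _ _ hr hs, h.coord_smul _ _ rfl, h.coord_smul _ _ rfl,
    _root_.add_smul]

theorem SmoothVB.smul_zero (A : SmoothVB X B) (r : ℝ) (b : B) : A.smul r (A.zero b) = A.zero b := by
  obtain ⟨W, κ, ι, h⟩ := A.exists_isFibreChart b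
  have h0 := A.proj_zero b
  refine h.ext ((A.proj_smul _ _).trans h0) h0 ?_
  rw [h.coord_smul _ _ h0, h.coord_zero, _root_.smul_zero]

theorem SmoothVB.continuous_smul_left (A : SmoothVB X B) (x : X) :
    Continuous fun r : ℝ => A.smul r x := by
  obtain ⟨W, κ, ι, h⟩ := A.exists_isFibreChart (A.proj x)
  have h1 : (fun r : ℝ => A.smul r x) = fun r => ι (r • κ x) := by
    funext r
    rw [h.param_smul, h.param_coord x rfl]
  rw [h1]
  exact h.smooth_param.continuous.comp (continuous_id.smul continuous_const)

end FibreChart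

theorem HasLocalRetractions.smoothMap_of_comp {X F F' : Type*} [TopologicalSpace X]
    [TopologicalSpace F] [SmoothMfd F] [TopologicalSpace F'] [SmoothMfd F'] {H E : Type*}
    [NormedAddCommGroup E] [NormedSpace ℝ E] [TopologicalSpace H] {I : ModelWithCorners ℝ E H}
    [ChartedSpace H X] {f : F → F'} (h : HasLocalRetractions f) {g : X → F}
    (hg : ContMDiff I (SmoothMfd.I F') ∞ (fun x => f (g x))) :
    ContMDiff I (SmoothMfd.I F) ∞ g := fun x => by
  obtain ⟨W, r, hW, hx, hr, hrf⟩ := h (g x)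
  have h1 : ContMDiffAt I (SmoothMfd.I F) ∞ (fun y => r (f (g y))) x :=
    (hr.contMDiffAt (hW.mem_nhds hx)).comp x (hg x)
  refine h1.congr_of_eventuallyEq ?_
  filter_upwards [(hW.preimage hg.continuous).mem_nhds hx] with y hy
  exact (hrf (g y) hy).symm

section Core

variable {V V₁ V₂ : Type*} [TopologicalSpace V] [SmoothMfd V]
  [TopologicalSpace V₁] [SmoothMfd V₁] [TopologicalSpace V₂] [SmoothMfd V₂]

theorem DoubleVB.mem_core_iff (𝕍 : DoubleVS V V₁ V₂) {v : V} :
    v ∈ 𝕍.core ↔ 𝕍.I.proj v = 𝕍.S₁.zero () ∧ 𝕍.II.proj v = 𝕍.S₂.zero () :=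
  ⟨fun ⟨_, h⟩ => h, fun h => ⟨(), h⟩⟩

/-- On the core, the two additions agree, by the interchange law. -/
theorem DoubleVB.add_eq_add_of_mem_core (𝕍 : DoubleVS V V₁ V₂) {v w : V} (hv : v ∈ 𝕍.core)
    (hw : w ∈ 𝕍.core) : 𝕍.II.add v w = 𝕍.I.add v w := by
  obtain ⟨hv1, hv2⟩ := 𝕍.mem_core_iff.1 hv
  obtain ⟨hw1, hw2⟩ := 𝕍.mem_core_iff.1 hw
  have ho : 𝕍.I.zero (𝕍.S₁.zero ()) = 𝕍.II.zero (𝕍.S₂.zero ()) := 𝕍.zeroI.map_zero ()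
  have ho1 : 𝕍.I.proj (𝕍.I.zero (𝕍.S₁.zero ())) = 𝕍.S₁.zero () := 𝕍.I.proj_zero _
  have ho2 : 𝕍.II.proj (𝕍.I.zero (𝕍.S₁.zero ())) = 𝕍.S₂.zero () := by
    rw [ho, 𝕍.II.proj_zero]
  have h1 := 𝕍.addI_add v (𝕍.I.zero (𝕍.S₁.zero ())) (𝕍.I.zero (𝕍.S₁.zero ())) w
    (hv1.trans ho1.symm) (ho1.trans hw1.symm) (hv2.trans ho2.symm) (ho2.trans hw2.symm)
  rw [𝕍.I.add_zero hv1, 𝕍.I.zero_add hw1, ho, 𝕍.II.add_zero hv2, 𝕍.II.zero_add hw2] at h1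
  exact h1.symm

theorem DoubleVB.smulII_mem_core (𝕍 : DoubleVS V V₁ V₂) (r : ℝ) {v : V} (hv : v ∈ 𝕍.core) :
    𝕍.II.smul r v ∈ 𝕍.core := by
  obtain ⟨hv1, hv2⟩ := 𝕍.mem_core_iff.1 hv
  refine 𝕍.mem_core_iff.2 ⟨?_, ?_⟩
  · rw [(𝕍.smulII r).proj, hv1, 𝕍.S₁.smul_zero]
  · rw [𝕍.II.proj_smul, hv2]

/-- On the core, the two scalar multiplications agree: they have the same addition and are
continuous in the scalar. -/
theorem DoubleVB.smul_eq_smul_of_mem_core (𝕍 : DoubleVS V V₁ V₂) (r : ℝ) {v : V}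
    (hv : v ∈ 𝕍.core) : 𝕍.II.smul r v = 𝕍.I.smul r v := by
  obtain ⟨W, κ, ι, h⟩ := 𝕍.I.exists_isFibreChart (𝕍.S₁.zero ())
  have hII := fun s : ℝ => 𝕍.smulII_mem_core s hv
  have hI1 := fun s : ℝ => (𝕍.mem_core_iff.1 (hII s)).1
  have hv1 := (𝕍.mem_core_iff.1 hv).1
  have hadd : ∀ s t : ℝ, κ (𝕍.II.smul (s + t) v) = κ (𝕍.II.smul s v) + κ (𝕍.II.smul t v) := by
    intro s t
    rw [𝕍.II.add_smul, 𝕍.add_eq_add_of_mem_core (hII s) (hII t), h.coord_add _ _ (hI1 s) (hI1 t)]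
  let f : ℝ →+ EuclideanSpace ℝ (Fin 𝕍.I.rank) := AddMonoidHom.mk' (fun s => κ (𝕍.II.smul s v)) hadd
  have hf : Continuous f :=
    h.smooth_coord.continuousOn.comp_continuous (𝕍.II.continuous_smul_left v)
      fun s => h.mem _ (hI1 s)
  have h1 : f (r • (1 : ℝ)) = r • f 1 := map_real_smul f hf r 1
  have h2 : κ (𝕍.II.smul r v) = r • κ v := by
    have h3 : f (r • (1 : ℝ)) = κ (𝕍.II.smul r v) := by
      rw [smul_eq_mul, mul_one]
      rfl
    rw [← h3, h1]
    change r • κ (𝕍.II.smul 1 v) = _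
    rw [𝕍.II.one_smul]
  refine h.ext (hI1 r) ((𝕍.I.proj_smul _ _).trans hv1) ?_
  rw [h2, h.coord_smul _ _ hv1]

/-- The core of a double vector space has a linear parametrization, since it is the kernel of
the linear map induced by `V → V₂` on the fibre of `V → V₁` over zero. -/
theorem DoubleVB.exists_core_chart (𝕍 : DoubleVS V V₁ V₂) :
    ∃ (d : ℕ) (W : Set V) (κ : V → EuclideanSpace ℝ (Fin d)) (ι : EuclideanSpace ℝ (Fin d) → V),
      IsOpen W ∧ 𝕍.core ⊆ W ∧ ContMDiffOn (SmoothMfd.I V) (𝓡 d) ∞ κ W ∧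
      ContMDiff (𝓡 d) (SmoothMfd.I V) ∞ ι ∧ (∀ y, ι y ∈ 𝕍.core) ∧ (∀ y, κ (ι y) = y) ∧
      (∀ v ∈ 𝕍.core, ι (κ v) = v) ∧ (∀ y z, ι (y + z) = 𝕍.I.add (ι y) (ι z)) ∧
      ∀ (r : ℝ) y, ι (r • y) = 𝕍.I.smul r (ι y) := by
  obtain ⟨W, κ, ι, h⟩ := 𝕍.I.exists_isFibreChart (𝕍.S₁.zero ())
  obtain ⟨W₂, κ₂, ι₂, h₂⟩ := 𝕍.S₂.exists_isFibreChart ()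
  let T : EuclideanSpace ℝ (Fin 𝕍.I.rank) →ₗ[ℝ] EuclideanSpace ℝ (Fin 𝕍.S₂.rank) :=
    { toFun := fun y => κ₂ (𝕍.II.proj (ι y))
      map_add' := fun y z => by
        have hp : 𝕍.I.proj (ι y) = 𝕍.I.proj (ι z) := by rw [h.proj_param, h.proj_param]
        rw [h.param_add, 𝕍.projII.add _ _ hp]
        exact h₂.coord_add _ _ rfl rfl
      map_smul' := fun r y => by
        rw [h.param_smul, 𝕍.projII.smul]
        exact h₂.coord_smul _ _ rfl }
  have hT : ∀ y, y ∈ T.ker ↔ ι y ∈ 𝕍.core := fun y => by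
    rw [LinearMap.mem_ker, 𝕍.mem_core_iff]
    constructor
    · intro hy
      exact ⟨h.proj_param y, h₂.ext rfl rfl (hy.trans h₂.coord_zero.symm)⟩
    · rintro ⟨-, hy⟩
      change κ₂ (𝕍.II.proj (ι y)) = 0
      rw [hy, h₂.coord_zero]
  obtain ⟨p₀, hp₀⟩ := T.ker.subtype.exists_leftInverse_of_injective T.ker.ker_subtype
  let p : EuclideanSpace ℝ (Fin 𝕍.I.rank) →L[ℝ] T.ker := LinearMap.toContinuousLinearMap p₀
  have hp : ∀ y : T.ker, p y = y := fun y => LinearMap.congr_fun hp₀ y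
  let L : T.ker ≃L[ℝ] EuclideanSpace ℝ (Fin (Module.finrank ℝ T.ker)) := toEuclidean
  have hcoord : ∀ v ∈ 𝕍.core, ((p (κ v) : T.ker) : EuclideanSpace ℝ (Fin 𝕍.I.rank)) = κ v := by
    intro v hv
    have h1 : κ v ∈ T.ker := by
      rw [hT, h.param_coord v (𝕍.mem_core_iff.1 hv).1]
      exact hv
    exact congrArg Subtype.val (hp ⟨κ v, h1⟩)
  refine ⟨Module.finrank ℝ T.ker, W, fun v => L (p (κ v)), fun y => ι (L.symm y : T.ker),
    h.isOpen, fun v hv => h.mem v (𝕍.mem_core_iff.1 hv).1, ?_, ?_, fun y => ?_, fun y => ?_,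
    fun v hv => ?_, fun y z => ?_, fun r y => ?_⟩
  · exact (L.contDiff.comp p.contDiff).contMDiff.comp_contMDiffOn h.smooth_coord
  · exact h.smooth_param.comp (T.ker.subtypeL.contDiff.comp L.symm.contDiff).contMDiff
  · exact (hT _).1 (L.symm y).2
  · simp only [h.coord_param, hp, ContinuousLinearEquiv.apply_symm_apply]
  · simp only [ContinuousLinearEquiv.symm_apply_apply, hcoord v hv]
    exact h.param_coord v (𝕍.mem_core_iff.1 hv).1
  · simp only [map_add, Submodule.coe_add, h.param_add]
  · simp only [map_smul, Submodule.coe_smul, h.param_smul]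

/-- The core of a double vector space is a vector space, embedded in `V`, whose linear structure is
the restriction of the first structure on `V`. -/
theorem DoubleVB.exists_core_smoothVB (𝕍 : DoubleVS V V₁ V₂) :
    ∃ (_ : SmoothMfd 𝕍.core) (A₀ : SmoothVB 𝕍.core Unit),
      SmoothMap (Subtype.val : 𝕍.core → V) ∧
      HasLocalRetractions (Subtype.val : 𝕍.core → V) ∧
      (∀ v w, (A₀.add v w : V) = 𝕍.I.add v w) ∧ ∀ (r : ℝ) v, (A₀.smul r v : V) = 𝕍.I.smul r v := by
  obtain ⟨d, W, κ, ι, hW, hcore, hκ, hι, hιmem, hκι, hικ, hadd, hsmul⟩ := 𝕍.exists_core_chart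
  let Φ : 𝕍.core ≃ₜ EuclideanSpace ℝ (Fin d) :=
    { toFun := fun v => κ v
      invFun := fun y => ⟨ι y, hιmem y⟩
      left_inv := fun v => Subtype.ext (hικ v v.2)
      right_inv := hκι
      continuous_toFun := hκ.continuousOn.comp_continuous continuous_subtype_val
        fun v => hcore v.2
      continuous_invFun := hι.continuous.subtype_mk _ }
  have hsrc : Φ.toOpenPartialHomeomorph.source = Set.univ := rfl
  let mf : SmoothMfd 𝕍.core :=
    { dim := d
      chartedSpace := Φ.toOpenPartialHomeomorph.singletonChartedSpace hsrc
      isManifold := Φ.toOpenPartialHomeomorph.isManifold_singleton hsrc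
      t2 := inferInstance
      secondCountable := inferInstance }
  have hΦ : ContMDiff (SmoothMfd.I 𝕍.core) (𝓡 d) ∞ Φ := fun v => by
    have h1 : ContMDiffAt (SmoothMfd.I 𝕍.core) (SmoothMfd.I 𝕍.core) ∞
        (chartAt (EuclideanSpace ℝ (Fin (SmoothMfd.dim 𝕍.core))) v) v :=
      SmoothMfd.contMDiffAt_chartAt (mem_chart_source _ _)
    exact h1
  have hΦs : ContMDiff (𝓡 d) (SmoothMfd.I 𝕍.core) ∞ Φ.symm := fun y => by
    have h1 : ContMDiffAt (SmoothMfd.I 𝕍.core) (SmoothMfd.I 𝕍.core) ∞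
        (chartAt (EuclideanSpace ℝ (Fin (SmoothMfd.dim 𝕍.core))) (Φ.symm y)).symm y :=
      SmoothMfd.contMDiffAt_chartAt_symm trivial
    exact h1
  let τ : Bundle.Trivialization (EuclideanSpace ℝ (Fin d)) (fun _ : 𝕍.core => ()) :=
    { toFun := fun v => ((), Φ v)
      invFun := fun z => Φ.symm z.2
      source := Set.univ
      target := Set.univ ×ˢ Set.univ
      map_source' := fun v _ => ⟨trivial, trivial⟩
      map_target' := fun z _ => trivial
      left_inv' := fun v _ => Φ.left_inv v
      right_inv' := fun z _ => Prod.ext rfl (Φ.right_inv z.2)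
      open_source := isOpen_univ
      open_target := isOpen_univ.prod isOpen_univ
      continuousOn_toFun := (continuous_const.prodMk Φ.continuous).continuousOn
      continuousOn_invFun := (Φ.symm.continuous.comp continuous_snd).continuousOn
      baseSet := Set.univ
      open_baseSet := isOpen_univ
      source_eq := rfl
      target_eq := rfl
      proj_toFun := fun v _ => rfl }
  let A₀ : SmoothVB 𝕍.core Unit :=
    { proj := fun _ => ()
      zero := fun _ => Φ.symm 0
      add := fun v w => Φ.symm (Φ v + Φ w)
      smul := fun r v => Φ.symm (r • Φ v)
      rank := d
      proj_zero := fun _ => rfl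
      proj_add := fun _ _ _ => rfl
      proj_smul := fun _ _ => rfl
      locally_trivial := fun _ => ⟨τ, trivial, (contMDiff_const.prodMk hΦ).contMDiffOn,
        (hΦs.comp contMDiff_snd).contMDiffOn, fun _ _ => Φ.right_inv _,
        fun _ _ _ _ => Φ.right_inv _, fun _ _ _ => Φ.right_inv _⟩ }
  refine ⟨mf, A₀, ?_, ?_, fun v w => ?_, fun r v => ?_⟩
  · have h1 : (Subtype.val : 𝕍.core → V) = fun v => ι (Φ v) := by
      funext v
      exact (hικ v v.2).symm
    rw [h1]
    exact hι.comp hΦ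
  · refine fun v => ⟨W, fun w => Φ.symm (κ w), hW, hcore v.2, hΦs.comp_contMDiffOn hκ,
      fun w _ => Φ.left_inv w⟩
  · change ι (κ v + κ w) = _
    rw [hadd, hικ v v.2, hικ w w.2]
  · change ι (r • κ v) = _
    rw [hsmul, hικ v v.2]

end Core

/-! ### The associated double vector bundle and its core -/

section Representation

variable {G G₁ G₂ G₀ : Type*}
  [Group G] [TopologicalSpace G] [SmoothMfd G] [LieGroup (SmoothMfd.I G) ∞ G]
  [Group G₁] [TopologicalSpace G₁] [SmoothMfd G₁] [LieGroup (SmoothMfd.I G₁) ∞ G₁]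
  [Group G₂] [TopologicalSpace G₂] [SmoothMfd G₂] [LieGroup (SmoothMfd.I G₂) ∞ G₂]
  [Group G₀] [TopologicalSpace G₀] [SmoothMfd G₀] [LieGroup (SmoothMfd.I G₀) ∞ G₀]
  {V V₁ V₂ : Type*} [TopologicalSpace V] [SmoothMfd V]
  [TopologicalSpace V₁] [SmoothMfd V₁] [TopologicalSpace V₂] [SmoothMfd V₂]
  {𝔾 : DoubleLieGroup G G₁ G₂ G₀} {𝕍 : DoubleVS V V₁ V₂}

theorem DoubleRep.coreAct_one (R : DoubleRep 𝔾 𝕍) (v : 𝕍.core) : R.coreAct 1 v = v :=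
  Subtype.ext (by simp [DoubleRep.coreAct])

theorem DoubleRep.coreAct_mul (R : DoubleRep 𝔾 𝕍) (g h : G) (v : 𝕍.core) :
    R.coreAct (g * h) v = R.coreAct g (R.coreAct h v) :=
  Subtype.ext (by simp [DoubleRep.coreAct])

theorem DoubleRep.smooth_coreAct (R : DoubleRep 𝔾 𝕍) [SmoothMfd 𝕍.core]
    (hval : SmoothMap (Subtype.val : 𝕍.core → V))
    (hret : HasLocalRetractions (Subtype.val : 𝕍.core → V)) :
    SmoothMap₂ fun z : G × 𝕍.core => R.coreAct z.1 z.2 :=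
  hret.smoothMap_of_comp
    (R.smooth.comp (contMDiff_fst.prodMk (hval.comp contMDiff_snd)))

/-- The action on the core is linear. -/
theorem DoubleRep.isVBHom_coreAct (R : DoubleRep 𝔾 𝕍) [SmoothMfd 𝕍.core]
    (hval : SmoothMap (Subtype.val : 𝕍.core → V))
    (hret : HasLocalRetractions (Subtype.val : 𝕍.core → V)) {A₀ : SmoothVB 𝕍.core Unit}
    (hadd : ∀ v w, (A₀.add v w : V) = 𝕍.I.add v w)
    (hsmul : ∀ (r : ℝ) v, (A₀.smul r v : V) = 𝕍.I.smul r v) (g : G) :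
    IsVBHom A₀ A₀ (R.coreAct g) (fun u => u) where
  smooth := (R.smooth_coreAct hval hret).comp (contMDiff_const.prodMk contMDiff_id)
  smooth_base := contMDiff_id
  proj _ := rfl
  add v w _ := Subtype.ext (by
    have hvw : 𝕍.I.proj (v : V) = 𝕍.I.proj (w : V) :=
      (𝕍.mem_core_iff.1 v.2).1.trans (𝕍.mem_core_iff.1 w.2).1.symm
    rw [hadd]
    change R.ρ g (A₀.add v w : V) = 𝕍.I.add (R.ρ g v) (R.ρ g w)
    rw [hadd, (R.hom g).homI.add _ _ hvw])
  smul r v := Subtype.ext (by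
    rw [hsmul]
    change R.ρ g (A₀.smul r v : V) = 𝕍.I.smul r (R.ρ g v)
    rw [hsmul, (R.hom g).homI.smul])

end Representation

/-- The bundle associated with the core of a double vector space is the core of the associated
double vector bundle. -/
theorem IsAssocVB.isCoreBundle {X G M V V₁ V₂ E E₁ E₂ K : Type*} [TopologicalSpace X] [SmoothMfd X]
    [Group G] [TopologicalSpace G] [SmoothMfd G] [TopologicalSpace M] [SmoothMfd M]
    [TopologicalSpace V] [SmoothMfd V] [TopologicalSpace V₁] [SmoothMfd V₁]
    [TopologicalSpace V₂] [SmoothMfd V₂] [TopologicalSpace E] [SmoothMfd E]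
    [TopologicalSpace E₁] [SmoothMfd E₁] [TopologicalSpace E₂] [SmoothMfd E₂]
    [TopologicalSpace K] [SmoothMfd K] {a : SmoothRightAction X G} {π : X → M}
    {l : G → V → V} {Q : E → M} {fr : X → V → E}
    {l₁ : G → V₁ → V₁} {Q₁ : E₁ → M} {fr₁ : X → V₁ → E₁}
    {l₂ : G → V₂ → V₂} {Q₂ : E₂ → M} {fr₂ : X → V₂ → E₂}
    {𝕍 : DoubleVS V V₁ V₂} [SmoothMfd 𝕍.core] {A₀ : SmoothVB 𝕍.core Unit}
    {lK : G → 𝕍.core → 𝕍.core} {QK : K → M} {frK : X → 𝕍.core → K}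
    {D : DoubleVB E E₁ E₂ M} {C : SmoothVB K M}
    (hI : IsAssocVB 𝕍.I D.I fr fr₁) (hII : IsAssocVB 𝕍.II D.II fr fr₂)
    (hS₁ : IsAssocVB 𝕍.S₁ D.S₁ fr₁ fun x _ => π x) (hS₂ : IsAssocVB 𝕍.S₂ D.S₂ fr₂ fun x _ => π x)
    (hC : IsAssocVB A₀ C frK fun x _ => π x)
    (H : IsAssocBundle a π l Q fr) (H₁ : IsAssocBundle a π l₁ Q₁ fr₁)
    (H₂ : IsAssocBundle a π l₂ Q₂ fr₂) (HK : IsAssocBundle a π lK QK frK)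
    (h : IsPrincipalBundle a ⊤ π)
    (hval : SmoothMap (Subtype.val : 𝕍.core → V))
    (hret : HasLocalRetractions (Subtype.val : 𝕍.core → V))
    (hadd : ∀ v w, (A₀.add v w : V) = 𝕍.I.add v w)
    (hsmul : ∀ (r : ℝ) v, (A₀.smul r v : V) = 𝕍.I.smul r v)
    {j : K → E} (hj : ∀ x v, j (frK x v) = fr x v) : IsCoreBundle D C j := by
  have hpair : ∀ k k', C.proj k = C.proj k' → ∃ x v w, k = frK x v ∧ k' = frK x w := by
    intro k k' hk
    obtain ⟨x, v, rfl⟩ := HK.surjective k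
    obtain ⟨w, rfl, -⟩ := hC.exists_frame_eq HK h.isAssocBundle_base h hk
    exact ⟨x, v, w, rfl, rfl⟩
  have hpI : ∀ v w : 𝕍.core, 𝕍.I.proj (v : V) = 𝕍.I.proj (w : V) := fun v w =>
    (𝕍.mem_core_iff.1 v.2).1.trans (𝕍.mem_core_iff.1 w.2).1.symm
  have hpII : ∀ v w : 𝕍.core, 𝕍.II.proj (v : V) = 𝕍.II.proj (w : V) := fun v w =>
    (𝕍.mem_core_iff.1 v.2).2.trans (𝕍.mem_core_iff.1 w.2).2.symm
  refine ⟨HasLocalRetractions.isSmoothEmb (HK.smoothMap H h hval hj)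
    (HK.hasLocalRetractions H h hret hj), ?_, fun k => ?_, fun k => ?_, fun k k' hk => ?_,
    fun k k' hk => ?_, fun r k => ?_, fun r k => ?_⟩
  · ext u
    constructor
    · rintro ⟨k, rfl⟩
      obtain ⟨x, v, rfl⟩ := HK.surjective k
      obtain ⟨hv1, hv2⟩ := 𝕍.mem_core_iff.1 v.2
      refine ⟨π x, ?_, ?_⟩
      · rw [hj, hI.proj, hv1]
        exact (hS₁.zero x ()).symm
      · rw [hj, hII.proj, hv2]
        exact (hS₂.zero x ()).symm
    · rintro ⟨m, hm1, hm2⟩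
      obtain ⟨x, v, rfl⟩ := H.surjective u
      have hm : m = π x := by
        rw [← D.S₁.proj_zero m, ← hm1, hI.proj, hS₁.proj]
      subst hm
      rw [hI.proj] at hm1
      rw [hII.proj] at hm2
      have hv1 := H₁.injective _ (hm1.trans (hS₁.zero x ()))
      have hv2 := H₂.injective _ (hm2.trans (hS₂.zero x ()))
      exact ⟨frK x ⟨v, 𝕍.mem_core_iff.2 ⟨hv1, hv2⟩⟩, hj _ _⟩
  · obtain ⟨x, v, rfl⟩ := HK.surjective k
    rw [hj, hI.proj, hS₁.proj, hC.proj]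
  · obtain ⟨x, v, rfl⟩ := HK.surjective k
    rw [hj, hII.proj, hS₂.proj, hC.proj]
  · obtain ⟨x, v, w, rfl, rfl⟩ := hpair k k' hk
    rw [hC.add x v w rfl, hj, hj, hj, hI.add _ _ _ (hpI v w), hadd]
  · obtain ⟨x, v, w, rfl, rfl⟩ := hpair k k' hk
    rw [hC.add x v w rfl, hj, hj, hj, hII.add _ _ _ (hpII v w), hadd,
      𝕍.add_eq_add_of_mem_core v.2 w.2]
  · obtain ⟨x, v, rfl⟩ := HK.surjective k
    rw [hC.smul, hj, hj, hI.smul, hsmul]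
  · obtain ⟨x, v, rfl⟩ := HK.surjective k
    rw [hC.smul, hj, hj, hII.smul, hsmul, 𝕍.smul_eq_smul_of_mem_core r v.2]

theorem theorem3p1 {G G₁ G₂ G₀ P P₁ P₂ M V V₁ V₂ : Type*}
    [Group G] [TopologicalSpace G] [SmoothMfd G] [LieGroup (SmoothMfd.I G) ∞ G]
    [Group G₁] [TopologicalSpace G₁] [SmoothMfd G₁] [LieGroup (SmoothMfd.I G₁) ∞ G₁]
    [Group G₂] [TopologicalSpace G₂] [SmoothMfd G₂] [LieGroup (SmoothMfd.I G₂) ∞ G₂]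
    [Group G₀] [TopologicalSpace G₀] [SmoothMfd G₀] [LieGroup (SmoothMfd.I G₀) ∞ G₀]
    [TopologicalSpace P] [SmoothMfd P] [TopologicalSpace P₁] [SmoothMfd P₁]
    [TopologicalSpace P₂] [SmoothMfd P₂] [TopologicalSpace M] [SmoothMfd M]
    [TopologicalSpace V] [SmoothMfd V] [TopologicalSpace V₁] [SmoothMfd V₁]
    [TopologicalSpace V₂] [SmoothMfd V₂]
    (𝔾 : DoubleLieGroup G G₁ G₂ G₀) (ℙ : DoublePB 𝔾 P P₁ P₂ M)
    (𝕍 : DoubleVS V V₁ V₂) (R : DoubleRep 𝔾 𝕍) :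
    -- smooth structures on the associated spaces (for the quotient topologies)
    ∃ (_ : SmoothMfd (ℙ.Total R)) (_ : SmoothMfd (ℙ.Side₁ R)) (_ : SmoothMfd (ℙ.Side₂ R))
      (_ : SmoothMfd (ℙ.Core R)),
      -- they are the quotient smooth structures
      IsSmoothSubmersion₂ (fun z : P × V => ℙ.q R z.1 z.2) ∧
      IsSmoothSubmersion₂ (fun z : P₁ × V₁ => ℙ.q₁ R z.1 z.2) ∧
      IsSmoothSubmersion₂ (fun z : P₂ × V₂ => ℙ.q₂ R z.1 z.2) ∧
      ∃ D : DoubleVB (ℙ.Total R) (ℙ.Side₁ R) (ℙ.Side₂ R) M,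
        -- the four projections
        (∀ p v, D.I.proj (ℙ.q R p v) = ℙ.q₁ R (ℙ.π₁ p) (𝕍.I.proj v)) ∧
        (∀ p v, D.II.proj (ℙ.q R p v) = ℙ.q₂ R (ℙ.π₂ p) (𝕍.II.proj v)) ∧
        (∀ p v, D.S₁.proj (ℙ.q₁ R p v) = ℙ.l₁ p) ∧
        (∀ p v, D.S₂.proj (ℙ.q₂ R p v) = ℙ.l₂ p) ∧
        -- the linear structures are induced by those of the double vector space
        (∀ p v, D.I.zero (ℙ.q₁ R (ℙ.π₁ p) v) = ℙ.q R p (𝕍.I.zero v)) ∧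
        (∀ p v w, 𝕍.I.proj v = 𝕍.I.proj w →
          D.I.add (ℙ.q R p v) (ℙ.q R p w) = ℙ.q R p (𝕍.I.add v w)) ∧
        (∀ (r : ℝ) p v, D.I.smul r (ℙ.q R p v) = ℙ.q R p (𝕍.I.smul r v)) ∧
        (∀ p v, D.II.zero (ℙ.q₂ R (ℙ.π₂ p) v) = ℙ.q R p (𝕍.II.zero v)) ∧
        (∀ p v w, 𝕍.II.proj v = 𝕍.II.proj w →
          D.II.add (ℙ.q R p v) (ℙ.q R p w) = ℙ.q R p (𝕍.II.add v w)) ∧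
        (∀ (r : ℝ) p v, D.II.smul r (ℙ.q R p v) = ℙ.q R p (𝕍.II.smul r v)) ∧
        (∀ p, D.S₁.zero (ℙ.l₁ p) = ℙ.q₁ R p (𝕍.S₁.zero ())) ∧
        (∀ p v w, D.S₁.add (ℙ.q₁ R p v) (ℙ.q₁ R p w) = ℙ.q₁ R p (𝕍.S₁.add v w)) ∧
        (∀ (r : ℝ) p v, D.S₁.smul r (ℙ.q₁ R p v) = ℙ.q₁ R p (𝕍.S₁.smul r v)) ∧
        (∀ p, D.S₂.zero (ℙ.l₂ p) = ℙ.q₂ R p (𝕍.S₂.zero ())) ∧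
        (∀ p v w, D.S₂.add (ℙ.q₂ R p v) (ℙ.q₂ R p w) = ℙ.q₂ R p (𝕍.S₂.add v w)) ∧
        (∀ (r : ℝ) p v, D.S₂.smul r (ℙ.q₂ R p v) = ℙ.q₂ R p (𝕍.S₂.smul r v)) ∧
        -- the core is the vector bundle `P ×_G V₀`, included by `[p, v] ↦ [p, v]`
        ∃ (C : SmoothVB (ℙ.Core R) M) (j : ℙ.Core R → ℙ.Total R),
          (∀ p v, C.proj (ℙ.q₀ R p v) = ℙ.l₁ (ℙ.π₁ p)) ∧
          (∀ p v, j (ℙ.q₀ R p v) = ℙ.q R p v) ∧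
          IsCoreBundle D C j := by

  have hP := ℙ.isPrincipalBundle
  obtain ⟨_, A₀, hval, hret, hadd, hsmul⟩ := 𝕍.exists_core_smoothVB
  have hρ1 : ∀ v, R.ρ 1 v = v := fun v => by simp
  have hρm : ∀ g h v, R.ρ (g * h) v = R.ρ g (R.ρ h v) := fun g h v => by simp
  have hρ₁1 : ∀ v, R.ρ₁ 1 v = v := fun v => by simp
  have hρ₁m : ∀ g h v, R.ρ₁ (g * h) v = R.ρ₁ g (R.ρ₁ h v) := fun g h v => by simp
  have hρ₂1 : ∀ v, R.ρ₂ 1 v = v := fun v => by simp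
  have hρ₂m : ∀ g h v, R.ρ₂ (g * h) v = R.ρ₂ g (R.ρ₂ h v) := fun g h v => by simp
  obtain ⟨mE, Q, H⟩ := hP.exists_isAssocBundle (l := fun g v => R.ρ g v) hρ1 hρm R.smooth
  obtain ⟨mE₁, Q₁, H₁⟩ :=
    ℙ.principal₁.exists_isAssocBundle (l := fun g v => R.ρ₁ g v) hρ₁1 hρ₁m R.smooth₁
  obtain ⟨mE₂, Q₂, H₂⟩ :=
    ℙ.principal₂.exists_isAssocBundle (l := fun g v => R.ρ₂ g v) hρ₂1 hρ₂m R.smooth₂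
  obtain ⟨mK, QK, HK⟩ := hP.exists_isAssocBundle (l := R.coreAct) R.coreAct_one R.coreAct_mul
    (R.smooth_coreAct hval hret)
  have H₁' := H₁.comp ℙ.principal_I.smooth ℙ.principal_I.surjective 𝔾.φ₁ (fun _ => rfl) ℙ.π₁_act
  have H₂' := H₂.comp ℙ.principal_II.smooth ℙ.principal_II.surjective 𝔾.φ₂
    (fun p => (ℙ.comm p).symm) ℙ.π₂_act
  have HM := hP.isAssocBundle_base
  obtain ⟨D, hI, hII, hS₁, hS₂⟩ := H.exists_doubleVB H₁' H₂' HM hP 𝕍 R.hom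
  obtain ⟨C, hC⟩ := HK.exists_smoothVB HM hP A₀ (R.isVBHom_coreAct hval hret hadd hsmul)
  obtain ⟨j, hj⟩ := HK.exists_map H hP (f₀ := Subtype.val) fun _ _ => rfl
  refine ⟨mE, mE₁, mE₂, mK, H.isSmoothSubmersion₂ hP hρ1 hρm R.smooth,
    H₁.isSmoothSubmersion₂ ℙ.principal₁ hρ₁1 hρ₁m R.smooth₁,
    H₂.isSmoothSubmersion₂ ℙ.principal₂ hρ₂1 hρ₂m R.smooth₂, D, hI.proj, hII.proj, ?_, ?_,
    hI.zero, hI.add, hI.smul, hII.zero, hII.add, hII.smul, ?_, ?_, ?_, ?_, ?_, ?_,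
    C, j, hC.proj, hj, hI.isCoreBundle hII hS₁ hS₂ hC H H₁' H₂' HK hP hval hret hadd hsmul hj⟩
  · intro p v
    obtain ⟨p, rfl⟩ := ℙ.principal_I.surjective p
    exact hS₁.proj p v
  · intro p v
    obtain ⟨p, rfl⟩ := ℙ.principal_II.surjective p
    exact (hS₂.proj p v).trans (ℙ.comm p)
  · intro p
    obtain ⟨p, rfl⟩ := ℙ.principal_I.surjective p
    exact hS₁.zero p ()
  · intro p v w
    obtain ⟨p, rfl⟩ := ℙ.principal_I.surjective p
    exact hS₁.add p v w rfl
  · intro r p v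
    obtain ⟨p, rfl⟩ := ℙ.principal_I.surjective p
    exact hS₁.smul r p v
  · intro p
    obtain ⟨p, rfl⟩ := ℙ.principal_II.surjective p
    rw [← ℙ.comm p]
    exact hS₂.zero p ()
  · intro p v w
    obtain ⟨p, rfl⟩ := ℙ.principal_II.surjective p
    exact hS₂.add p v w rfl
  · intro r p v
    obtain ⟨p, rfl⟩ := ℙ.principal_II.surjective p
    exact hS₂.smul r p v
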